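/- \textbf{Setting.} Let $G=(V,E)$ be a finite undirected simple graph with edge costs $c_e\ge 0$, and let $(s_1,t_1),\dots,(s_r,t_r)$ be source-sink pairs. Two nodes $s,t$ of a graph are \emph{at least $2$-node-connected} in it if it contains two distinct simple $s$-$t$ paths that share no node other than $s,t$; otherwise they are \emph{at most $1$-node-connected}. In edge-deletion $2$-route node-multicut, a set $F\subseteq E$ is \emph{feasible} if every pair $s_i,t_i$ is at most $1$-node-connected in $(V,E\setminus F)$. Consider the linear program $$\text{(P2)}\qquad \min\ \sum_{e\in E} c_ex_e\quad\text{s.t.}\quad \sum_{e\in E(P)}x_e+\sum_{v\in V(P)}y^i_v\ \ge 1\ \ (\forall i,\ \forall P\in\mathcal P_i),\qquad \sum_v y^i_v\le 1,\quad y^i_{s_i}=y^i_{t_i}=0\ \ (\forall i),\qquad x,y\ge 0,$$ where $\mathcal P_i$ is the set of simple $s_i$-$t_i$ paths of $G$, and $E(P)$, $V(P)$ are the edges and nodes of $P$. Let $(x,\{y^i\})$ be an optimal solution of (P2), $\mathrm{OPT}_{LP}$ its value and $\beta=\mathrm{OPT}_{LP}/r$. \textbf{Regions.} Let $\ell^i(u;v)$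 be the minimum of $\sum_{e\in E(P)}x_e+\sum_{w\in V(P),\,w\ne u}y^i_w$ over all $u$-$v$ paths $P$ of $G$ ($\infty$ if there is none). For $S\subseteq V$ let $E(S)$ be the set of edges with both endpoints in $S$, and $\mathcal V(S)=\beta+\sum_{e\in E(S)}c_ex_e$. For a commodity $i$ and $\rho\ge 0$ put $B=\{v\in S:\ell^i(s_i;v)\le\rho\}$, $\Gamma=\{v\in S:\rho<\ell^i(s_i;v)\le\rho+y^i_v\}$, $\overline B=S\setminus(B\cup\Gamma)$, $\partial=\{uv\in E: u,v\in S,\ \ell^i(s_i;u)\le\rho,\ \ell^i(s_i;v)-y^i_v>\rho\}$, $$\mathcal V(\rho)=\beta+\sum_{uv\in E:\,u\in B,\,v\in B\cup\Gamma}c_{uv}x_{uv}+\sum_{uv\in\partial:\,u\in B}c_{uv}\bigl(\rho-\ell^i(s_i;u)\bigr),$$ $$\overline{\mathcal V}(\rho)=\beta+\sum_{uv\in E:\,u\in\overline B,\,v\in\overline B\cup\Gamma}c_{uv}x_{uv}+\sum_{uv\in\partial:\,u\in B}c_{uv}\bigl(\ell^i(s_i;v)-\rho-y^i_v\bigr).$$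 Call $\rho\in[0,1)$ \emph{good} for $(S,i)$ if $|\Gamma|<2$, $c(\partial)\le 4\,\mathcal V(\rho)\ln\frac{e\mathcal V(S)}{\mathcal V(\rho)}\,\ln\ln(e(r+1))$ and $c(\partial)\le 4\,\overline{\mathcal V}(\rho)\ln\frac{e\mathcal V(S)}{\overline{\mathcal V}(\rho)}\,\ln\ln(e(r+1))$, where a right-hand side whose volume factor $\mathcal V(\rho)$ or $\overline{\mathcal V}(\rho)$ is $0$ is read as $0$. \textbf{Algorithm ED-2-NMCAlg}$(U,\mathcal T)$, for $U\subseteq V$ and a set $\mathcal T$ of $N$ of the pairs, all inside $U$. Start with $S=U$, $Z=\emptyset$, $\mathcal S=\emptyset$. While some pair of $\mathcal T$ is at least $2$-node-connected in $(S,E(S))$: pick any such pair $(s_i,t_i)$ and any $\rho$ that is good for $(S,i)$; let $A=B$ if $B\cup\Gamma$ contains at most $N/2$ pairs of $\mathcal T$, and $A=\overline B$ otherwise; add $A\cup\Gamma$ to $\mathcal S$, add $\partial$ to $Z$, and replace $S$ by $S\setminus A$. After the loop, for every $A\in\mathcal S$ add to $Z$ the result of ED-2-NMCAlg$(A,\{(s_i,t_i)\in\mathcal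 T:s_i,t_i\in A\})$. Return $Z$. \textbf{Theorem.} Whatever choices are made, ED-2-NMCAlg$(V,\{(s_1,t_1),\dots,(s_r,t_r)\})$ never gets stuck (a good radius always exists when one is needed), terminates, and returns a set $Z\subseteq E$ such that every pair $s_i,t_i$ is at most $1$-node-connected in $(V,E\setminus Z)$, and $$\sum_{e\in Z}c_e\ \le\ f(r)\cdot\mathrm{OPT}_{LP},$$ where $f:\mathbb N\to\mathbb R$ is a universal function (depending on nothing but $r$) with $f(r)=O(\ln r\,\ln\ln r)$ as $r\to\infty$. -/

import Mathlib

open Filter Asymptotics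

namespace EDNMC

/-- There are at least `k` node-disjoint `s`-`t` paths in `H`: `k` distinct simple `s`-`t` paths,
no two of which share a node other than `s` and `t`. -/
def NodeConnected {V : Type*} (H : SimpleGraph V) (k : ℕ) (s t : V) : Prop :=
  ∃ P : Fin k → H.Path s t, ∀ a b : Fin k, a ≠ b →
    P a ≠ P b ∧ ∀ v ∈ (P a).1.support, v ∈ (P b).1.support → v = s ∨ v = t

/-- An instance of edge-deletion `k`-route node-multicut: an undirected graph, nonnegative edge
costs (only the values of `c` on edges of `G` matter) and `r` source-sink pairs. -/
structure Problem (V : Type*) (r : ℕ) where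
  G : SimpleGraph V
  c : Sym2 V → ℝ
  c_nonneg : ∀ e ∈ G.edgeSet, 0 ≤ c e
  s : Fin r → V
  t : Fin r → V

/-- A vector of LP variables: `x e` for the edges and `y i v` for the commodities and nodes. -/
structure LPSol (V : Type*) (r : ℕ) where
  x : Sym2 V → ℝ
  y : Fin r → V → ℝ

section

variable {V : Type*} [Fintype V] [DecidableEq V] {r : ℕ}

open Classical in
/-- `E(S)`: the edges of `G` with both endpoints in `S`. -/
noncomputable def Problem.edgesIn (I : Problem V r) (S : Finset V) : Finset (Sym2 V) :=
  {e | e ∈ I.G.edgeSet ∧ ∀ v ∈ e, v ∈ S}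

/-- The cost `c(F)` of an edge set. -/
def Problem.cost (I : Problem V r) (F : Finset (Sym2 V)) : ℝ := ∑ e ∈ F, I.c e

/-- The LP objective `∑ c_e x_e`, the sum running over all edges of the graph. -/
noncomputable def Problem.value (I : Problem V r) (p : LPSol V r) : ℝ :=
  ∑ e ∈ I.edgesIn Finset.univ, I.c e * p.x e

/-- The constraints of the LP relaxation of edge-deletion `k`-route node-multicut. -/
structure Problem.IsFeasible (I : Problem V r) (k : ℕ) (p : LPSol V r) : Prop where
  path : ∀ (i : Fin r) (P : I.G.Path (I.s i) (I.t i)),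
    1 ≤ ∑ e ∈ P.1.edges.toFinset, p.x e + ∑ v ∈ P.1.support.toFinset, p.y i v
  sum_y : ∀ i, ∑ v, p.y i v ≤ (k : ℝ) - 1
  y_source : ∀ i, p.y i (I.s i) = 0
  y_sink : ∀ i, p.y i (I.t i) = 0
  x_nonneg : ∀ e ∈ I.G.edgeSet, 0 ≤ p.x e
  y_nonneg : ∀ i v, 0 ≤ p.y i v

/-- `p` is an optimal solution of the LP relaxation. -/
def Problem.IsOptimal (I : Problem V r) (k : ℕ) (p : LPSol V r) : Prop :=
  I.IsFeasible k p ∧ ∀ p' : LPSol V r, I.IsFeasible k p' → I.value p ≤ I.value p'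

/-- The asymmetric distance `ℓ^i(u;v)`: the minimum over all `u`-`v` paths of the `x`-length of
the edges plus the `y^i`-length of the nodes other than `u` (and `⊤` if there is no path). -/
noncomputable def Problem.dist (I : Problem V r) (p : LPSol V r) (i : Fin r) (u v : V) : EReal :=
  ⨅ P : I.G.Path u v,
    ((∑ e ∈ P.1.edges.toFinset, p.x e + ∑ w ∈ P.1.support.toFinset.erase u, p.y i w : ℝ) : EReal)

open Classical in
/-- The ball `B^S_i(z,ρ)`. -/
noncomputable def Problem.ball (I : Problem V r) (p : LPSol V r) (S : Finset V) (i : Fin r)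
    (z : V) (ρ : ℝ) : Finset V :=
  {v ∈ S | I.dist p i z v ≤ (ρ : EReal)}

open Classical in
/-- The node-boundary `Γ^{S,y}_i(z,ρ)`: the nodes `v ∈ S` with `ρ < ℓ^i(z;v) ≤ ρ + y^i_v`. -/
noncomputable def Problem.nodeBdry (I : Problem V r) (p : LPSol V r) (S : Finset V) (i : Fin r)
    (z : V) (ρ : ℝ) : Finset V :=
  {v ∈ S | (ρ : EReal) < I.dist p i z v ∧ I.dist p i z v ≤ ((ρ + p.y i v : ℝ) : EReal)}

/-- The complement `S ∖ (B^S_i(z,ρ) ∪ Γ^{S,y}_i(z,ρ))`. -/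
noncomputable def Problem.coBall (I : Problem V r) (p : LPSol V r) (S : Finset V) (i : Fin r)
    (z : V) (ρ : ℝ) : Finset V :=
  S \ (I.ball p S i z ρ ∪ I.nodeBdry p S i z ρ)

open Classical in
/-- The boundary edges, oriented away from the ball: the pairs `(u,v)` of adjacent nodes of `S`
with `ℓ^i(z;u) ≤ ρ` and `ℓ^i(z;v) - y^i_v > ρ`. Every boundary edge has exactly one such
orientation. -/
noncomputable def Problem.bdryPairs (I : Problem V r) (p : LPSol V r) (S : Finset V) (i : Fin r)
    (z : V) (ρ : ℝ) : Finset (V × V) :=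
  {a | I.G.Adj a.1 a.2 ∧ a.1 ∈ S ∧ a.2 ∈ S ∧ I.dist p i z a.1 ≤ (ρ : EReal) ∧
    ((ρ + p.y i a.2 : ℝ) : EReal) < I.dist p i z a.2}

/-- The edge-boundary `∂^{S,x}_i(z,ρ)` as a set of edges. -/
noncomputable def Problem.edgeBdry (I : Problem V r) (p : LPSol V r) (S : Finset V) (i : Fin r)
    (z : V) (ρ : ℝ) : Finset (Sym2 V) :=
  (I.bdryPairs p S i z ρ).image fun a => s(a.1, a.2)

open Classical in
/-- The edges of `G` with one endpoint in `A` and the other one in `B`. -/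
noncomputable def Problem.edgesBetween (I : Problem V r) (A B : Finset V) : Finset (Sym2 V) :=
  {e | e ∈ I.G.edgeSet ∧ ∃ u ∈ A, ∃ v ∈ B, e = s(u, v)}

/-- `β = OPT / r`, where `OPT` is the value of the LP solution. -/
noncomputable def Problem.beta (I : Problem V r) (p : LPSol V r) : ℝ := I.value p / r

/-- The volume `𝒱^x(S)`. -/
noncomputable def Problem.volSet (I : Problem V r) (p : LPSol V r) (S : Finset V) : ℝ :=
  I.beta p + ∑ e ∈ I.edgesIn S, I.c e * p.x e

/-- The volume `𝒱^{S,x}_i(z,ρ)` of the ball. -/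
noncomputable def Problem.vol (I : Problem V r) (p : LPSol V r) (S : Finset V) (i : Fin r)
    (z : V) (ρ : ℝ) : ℝ :=
  I.beta p
    + ∑ e ∈ I.edgesBetween (I.ball p S i z ρ) (I.ball p S i z ρ ∪ I.nodeBdry p S i z ρ),
        I.c e * p.x e
    + ∑ a ∈ I.bdryPairs p S i z ρ, I.c s(a.1, a.2) * (ρ - (I.dist p i z a.1).toReal)

/-- The volume of the complement of the ball. -/
noncomputable def Problem.coVol (I : Problem V r) (p : LPSol V r) (S : Finset V) (i : Fin r)
    (z : V) (ρ : ℝ) : ℝ :=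
  I.beta p
    + ∑ e ∈ I.edgesBetween (I.coBall p S i z ρ) (I.coBall p S i z ρ ∪ I.nodeBdry p S i z ρ),
        I.c e * p.x e
    + ∑ a ∈ I.bdryPairs p S i z ρ,
        I.c s(a.1, a.2) * ((I.dist p i z a.2).toReal - ρ - p.y i a.2)

/-- The requirements on the radius that the region-growing step has to find: `ρ ∈ [0,1)`, the
cost of the edge-boundary is bounded in terms of both volumes, and the node-boundary has fewer
than `⌈(k-1)/α⌉` nodes. -/
structure Problem.GoodRadius (I : Problem V r) (k : ℕ) (α : ℝ) (p : LPSol V r) (S : Finset V)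
    (i : Fin r) (z : V) (ρ : ℝ) : Prop where
  nonneg : 0 ≤ ρ
  lt_one : ρ < 1
  cost_le_vol : I.cost (I.edgeBdry p S i z ρ) ≤
    2 / (1 - α) * I.vol p S i z ρ
      * Real.log (Real.exp 1 * I.volSet p S / I.vol p S i z ρ)
      * Real.log (Real.log (Real.exp 1 * ((r : ℝ) + 1)))
  cost_le_coVol : I.cost (I.edgeBdry p S i z ρ) ≤
    2 / (1 - α) * I.coVol p S i z ρ
      * Real.log (Real.exp 1 * I.volSet p S / I.coVol p S i z ρ)
      * Real.log (Real.log (Real.exp 1 * ((r : ℝ) + 1)))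
  card_lt : (I.nodeBdry p S i z ρ).card < ⌈((k : ℝ) - 1) / α⌉₊

open Classical in
/-- The pairs from `T` both of whose members lie in `A`. -/
noncomputable def Problem.pairsIn (I : Problem V r) (T : Finset (Fin r)) (A : Finset V) :
    Finset (Fin r) :=
  {i ∈ T | I.s i ∈ A ∧ I.t i ∈ A}

open Classical in
/-- `𝒯'`: the pairs from `T` that are at least 2-node-connected in `(S, E(S))`. (The graph
`fromEdgeSet E(S)` has all of `V` as its nodes, but the nodes outside `S` are isolated in it.) -/
noncomputable def Problem.active (I : Problem V r) (T : Finset (Fin r)) (S : Finset V) :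
    Finset (Fin r) :=
  {i ∈ T | NodeConnected (SimpleGraph.fromEdgeSet (I.edgesIn S : Set (Sym2 V))) 2 (I.s i) (I.t i)}

/-- The variables of one invocation of the algorithm: the current node set `S`, the current edge
set `Z` and the collection `parts` of node sets to recurse on. -/
structure LoopState (V : Type*) where
  S : Finset V
  Z : Finset (Sym2 V)
  parts : Finset (Finset V)

open Classical in
/-- The set `A` that is carved out of `S`: the ball if ball and node-boundary together contain at
most half of the pairs from `T`, and the complement otherwise. -/
noncomputable def Problem.carve (I : Problem V r) (p : LPSol V r) (T : Finset (Fin r))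
    (S : Finset V) (i : Fin r) (ρ : ℝ) : Finset V :=
  if ((I.pairsIn T (I.ball p S i (I.s i) ρ ∪ I.nodeBdry p S i (I.s i) ρ)).card : ℝ)
      ≤ (T.card : ℝ) / 2 then
    I.ball p S i (I.s i) ρ
  else
    I.coBall p S i (I.s i) ρ

/-- The state after an iteration of the while loop that uses the pair `i` and the radius `ρ`. -/
noncomputable def Problem.next (I : Problem V r) (p : LPSol V r) (T : Finset (Fin r))
    (σ : LoopState V) (i : Fin r) (ρ : ℝ) : LoopState V where
  S := σ.S \ I.carve p T σ.S i ρ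
  Z := σ.Z ∪ I.edgeBdry p σ.S i (I.s i) ρ
  parts := insert (I.carve p T σ.S i ρ ∪ I.nodeBdry p σ.S i (I.s i) ρ) σ.parts

/-- One iteration of the while loop (`k = 2`, `α = 1/2`): pick any pair that is still at least
2-node-connected in `(S, E(S))` and any radius that meets the requirements. -/
def Problem.LoopStep (I : Problem V r) (p : LPSol V r) (T : Finset (Fin r))
    (σ σ' : LoopState V) : Prop :=
  ∃ i ∈ I.active T σ.S, ∃ ρ : ℝ,
    I.GoodRadius 2 (1 / 2) p σ.S i (I.s i) ρ ∧ σ' = I.next p T σ i ρ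

/-- `σ` is a state that the while loop of the invocation on `(U, T)` can reach. -/
def Problem.LoopReaches (I : Problem V r) (p : LPSol V r) (U : Finset V) (T : Finset (Fin r))
    (σ : LoopState V) : Prop :=
  Relation.ReflTransGen (I.LoopStep p T) ⟨U, ∅, ∅⟩ σ

/-- `I.Returns p U T Z`: some execution of the algorithm on the node set `U` and the set `T` of
pairs returns the edge set `Z`. The while loop runs until no pair is active; then the algorithm
is called on every member `A` of the collection with the pairs from `T` inside `A`, and the
returned sets `W A` are added to the set `Z` of the loop. -/
inductive Problem.Returns (I : Problem V r) (p : LPSol V r) :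
    Finset V → Finset (Fin r) → Finset (Sym2 V) → Prop
  | mk (U : Finset V) (T : Finset (Fin r)) (σ : LoopState V) (W : Finset V → Finset (Sym2 V))
      (reach : I.LoopReaches p U T σ) (done : I.active T σ.S = ∅)
      (rec : ∀ A ∈ σ.parts, Problem.Returns I p A (I.pairsIn T A) (W A)) :
      Problem.Returns I p U T (σ.Z ∪ σ.parts.biUnion W)

/-- `I.Halts p U T`: every execution of the algorithm on `(U, T)` is finite and never gets stuck,
whatever choices are made. That is, the while loop has no infinite run; in every reachable state
there is a radius as required for every active pair; and all the recursive calls made after the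
loop halt as well. -/
inductive Problem.Halts (I : Problem V r) (p : LPSol V r) :
    Finset V → Finset (Fin r) → Prop
  | mk (U : Finset V) (T : Finset (Fin r))
      (finite : Acc (fun σ' σ => I.LoopStep p T σ σ') ⟨U, ∅, ∅⟩)
      (progress : ∀ σ, I.LoopReaches p U T σ → ∀ i ∈ I.active T σ.S,
        ∃ ρ, I.GoodRadius 2 (1 / 2) p σ.S i (I.s i) ρ)
      (rec : ∀ σ, I.LoopReaches p U T σ → I.active T σ.S = ∅ →
        ∀ A ∈ σ.parts, Problem.Halts I p A (I.pairsIn T A)) :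
      Problem.Halts I p U T

end

end EDNMC

/-!
In a region growing step, `ρ` is chosen outside three bad sets that do not fill `[0, 1)`. Each
volume is monotone in `ρ` with derivative `± c(∂)` almost everywhere, and `ln ln (e 𝒱(S) / 𝒱(ρ))`
has total variation at most `ln ln (e (r + 1))`, so each of the two cost bounds fails on measure
less than `1/4`. Since `∑ y ≤ 1`, the node-boundary has two nodes or more on measure at most `1/2`.

The node set `A ∪ Γ` and the remaining node set share at most one node, and deleting `∂` leaves no
edge between them; hence two disjoint paths with the same ends cannot use both, which yields
feasibility by induction. The cost bound is amortized: a call on a set of edge weight `W` with `n`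
pairs charges `ln ((β + W) / β) + O(ln n)` to every unit of volume carved out. The boundary of a
part of volume `v` costs `O(v (1 + ln (𝒱(S) / v)))`, the recursive call charges `ln (v / β)` and has
at most `n / 2` pairs, so that the logarithms telescope. Every step separates the pair it has
picked, and this pair pays for the additive `β` in the volume.
-/

namespace EDNMC

section Analysis

open MeasureTheory Set

theorem measure_lt_of_lintegral_le {α : Type*} [MeasurableSpace α] {μ : Measure α}
    {f : α → ENNReal} (hf : Measurable f) {c L : ENNReal} (hc : c ≠ 0) (hc' : c ≠ ⊤)
    (hL : L ≠ 0) (hL' : L ≠ ⊤) (h : ∫⁻ x, f x ∂μ ≤ L) : μ {x | c < f x} < L / c := by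
  set s : Set α := {x | c < f x}
  have hs : MeasurableSet s := measurableSet_lt measurable_const hf
  rcases eq_or_ne (μ s) 0 with h0 | h0
  · rw [h0]
    exact ENNReal.div_pos hL hc'
  have hsL : ∫⁻ x in s, f x ∂μ ≤ L := (setLIntegral_le_lintegral s f).trans h
  have hcs : ∫⁻ _ in s, c ∂μ ≤ ∫⁻ x in s, f x ∂μ := setLIntegral_mono hf fun _ hx => le_of_lt hx
  have hlt : ∫⁻ _ in s, c ∂μ < ∫⁻ x in s, f x ∂μ :=
    setLIntegral_strict_mono hs h0 hf (ne_top_of_le_ne_top hL' (hcs.trans hsL))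
      (.of_forall fun _ hx => hx)
  rw [setLIntegral_const, mul_comm] at hlt
  exact (ENNReal.lt_div_iff_mul_lt (.inl hc) (.inl hc')).2 (mul_comm c _ ▸ hlt.trans_le hsL)

theorem lintegral_abs_deriv_le_of_monotoneOn {φ : ℝ → ℝ} {a b L : ℝ} (hab : a ≤ b)
    (hφ : MonotoneOn φ (Icc a b)) (hL : |φ b - φ a| ≤ L) :
    ∫⁻ ρ in Ioo a b, ENNReal.ofReal |deriv φ ρ| ≤ ENNReal.ofReal L := by
  have hφ' : MonotoneOn φ (uIcc a b) := by rwa [uIcc_of_le hab]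
  have hnn : ∀ ρ ∈ Ioo a b, 0 ≤ deriv φ ρ := fun ρ hρ => by
    rw [← derivWithin_of_mem_nhds (Icc_mem_nhds hρ.1 hρ.2)]
    exact hφ.derivWithin_nonneg
  have hint : IntegrableOn (deriv φ) (Ioo a b) :=
    (intervalIntegrable_iff_integrableOn_Ioo_of_le hab).1 hφ'.intervalIntegrable_deriv
  have hle : ∫ ρ in Ioo a b, deriv φ ρ ≤ L := by
    have h := hφ'.intervalIntegral_deriv_mem_uIcc
    rw [intervalIntegral.integral_of_le hab, integral_Ioc_eq_integral_Ioo, uIcc_of_le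
      (sub_nonneg.2 (hφ (left_mem_Icc.2 hab) (right_mem_Icc.2 hab) hab))] at h
    exact h.2.trans ((le_abs_self _).trans hL)
  calc ∫⁻ ρ in Ioo a b, ENNReal.ofReal |deriv φ ρ|
      = ∫⁻ ρ in Ioo a b, ENNReal.ofReal (deriv φ ρ) :=
        setLIntegral_congr_fun measurableSet_Ioo fun ρ hρ => by
          simp only [abs_of_nonneg (hnn ρ hρ)]
    _ = ENNReal.ofReal (∫ ρ in Ioo a b, deriv φ ρ) :=
        (ofReal_integral_eq_lintegral_ofReal hint
          ((ae_restrict_iff' measurableSet_Ioo).2 (.of_forall hnn))).symm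
    _ ≤ ENNReal.ofReal L := ENNReal.ofReal_le_ofReal hle

theorem volume_lt_abs_deriv_lt {φ : ℝ → ℝ} {a b c L : ℝ} (hab : a ≤ b)
    (hφ : MonotoneOn φ (Icc a b) ∨ AntitoneOn φ (Icc a b)) (hc : 0 < c) (hL : 0 < L)
    (h : |φ b - φ a| ≤ L) :
    volume ({ρ | c < |deriv φ ρ|} ∩ Ioo a b) < ENNReal.ofReal (L / c) := by
  have hmono : ∫⁻ ρ in Ioo a b, ENNReal.ofReal |deriv φ ρ| ≤ ENNReal.ofReal L := by
    rcases hφ with hφ | hφ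
    · exact lintegral_abs_deriv_le_of_monotoneOn hab hφ h
    · simpa [abs_neg] using lintegral_abs_deriv_le_of_monotoneOn hab hφ.neg (L := L)
        (by rwa [← neg_sub', abs_neg])
  have hset : {ρ | c < |deriv φ ρ|} = {ρ | ENNReal.ofReal c < ENNReal.ofReal |deriv φ ρ|} := by
    ext ρ
    exact (ENNReal.ofReal_lt_ofReal_iff_of_nonneg hc.le).symm
  rw [ENNReal.ofReal_div_of_pos hc, ← Measure.restrict_apply' measurableSet_Ioo, hset]
  exact measure_lt_of_lintegral_le (measurable_deriv φ).abs.ennreal_ofReal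
    (ENNReal.ofReal_pos.2 hc).ne' ENNReal.ofReal_ne_top (ENNReal.ofReal_pos.2 hL).ne'
    ENNReal.ofReal_ne_top hmono

theorem mul_measure_le_card_filter_mem {α ι : Type*} [MeasurableSpace α] (μ : Measure α)
    (S : Finset ι) {A : ι → Set α} [∀ x, DecidablePred fun v => x ∈ A v]
    (hA : ∀ v ∈ S, MeasurableSet (A v)) (n : ℕ) :
    n * μ {x | n ≤ (S.filter fun v => x ∈ A v).card} ≤ ∑ v ∈ S, μ (A v) := by
  have hcard : ∀ x, ((S.filter fun v => x ∈ A v).card : ENNReal)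
      = ∑ v ∈ S, (A v).indicator 1 x := fun x => by
    classical simp [indicator_apply]
  have hmeas : ∀ v ∈ S, Measurable ((A v).indicator (1 : α → ENNReal)) := fun v hv =>
    measurable_one.indicator (hA v hv)
  calc n * μ {x | n ≤ (S.filter fun v => x ∈ A v).card}
      = n * μ {x | (n : ENNReal) ≤ ∑ v ∈ S, (A v).indicator 1 x} := by
        simp only [← hcard, Nat.cast_le]
    _ ≤ ∫⁻ x, ∑ v ∈ S, (A v).indicator 1 x ∂μ :=
        mul_meas_ge_le_lintegral (Finset.measurable_fun_sum S hmeas) n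
    _ = ∑ v ∈ S, μ (A v) := by
        rw [lintegral_finsetSum' _ fun v hv => (hmeas v hv).aemeasurable]
        exact Finset.sum_congr rfl fun v hv => lintegral_indicator_one (hA v hv)

/-- The iterated logarithm `ln ln (e y)`, which is defined and nonnegative for all `y ≥ 1`. -/
noncomputable def logLog (y : ℝ) : ℝ := Real.log (Real.log (Real.exp 1 * y))

theorem one_le_log_exp_one_mul {y : ℝ} (hy : 1 ≤ y) : 1 ≤ Real.log (Real.exp 1 * y) := by
  rw [Real.log_mul (Real.exp_ne_zero 1) (by positivity), Real.log_exp]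
  exact le_add_of_nonneg_right (Real.log_nonneg hy)

theorem logLog_nonneg {y : ℝ} (hy : 1 ≤ y) : 0 ≤ logLog y :=
  Real.log_nonneg (one_le_log_exp_one_mul hy)

theorem logLog_monotoneOn : MonotoneOn logLog (Ici 1) := fun y (hy : 1 ≤ y) z _ hyz => by
  have := one_le_log_exp_one_mul hy
  unfold logLog
  gcongr

theorem logLog_pos {y : ℝ} (hy : 1 < y) : 0 < logLog y := by
  refine Real.log_pos ?_
  rw [Real.log_mul (Real.exp_ne_zero 1) (by positivity), Real.log_exp]
  exact lt_add_of_pos_right 1 (Real.log_pos hy)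

theorem logLog_div_antitoneOn (M : ℝ) : AntitoneOn (fun v => logLog (M / v)) (Ioc 0 M) :=
  fun _ hv _ hw hvw => logLog_monotoneOn ((one_le_div hw.1).2 hw.2) ((one_le_div hv.1).2 hv.2)
    (div_le_div_of_nonneg_left (hv.1.le.trans hv.2) hv.1 hvw)

theorem logLog_div_mem_Icc {m M R v : ℝ} (hm : 0 < m) (hM : M ≤ m * R) (hv : v ∈ Icc m M) :
    logLog (M / v) ∈ Icc 0 (logLog R) := by
  have hv0 : 0 < v := hm.trans_le hv.1
  have hMv : 1 ≤ M / v := (one_le_div hv0).2 hv.2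
  have hMvR : M / v ≤ R := calc
    M / v ≤ M / m := div_le_div_of_nonneg_left (hv0.le.trans hv.2) hm hv.1
    _ ≤ R := (div_le_iff₀' hm).2 hM
  exact ⟨logLog_nonneg hMv, logLog_monotoneOn hMv (hMv.trans hMvR) hMvR⟩

theorem hasDerivAt_logLog_div {v : ℝ → ℝ} {M v' ρ : ℝ} (hv : 0 < v ρ) (hM : v ρ ≤ M)
    (h : HasDerivAt v v' ρ) :
    HasDerivAt (fun ρ => logLog (M / v ρ)) (-(v' / (v ρ * Real.log (Real.exp 1 * M / v ρ)))) ρ := by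
  have hM0 : 0 < M := hv.trans_le hM
  have hlog := one_le_log_exp_one_mul ((one_le_div hv).2 hM)
  have hd := ((((hasDerivAt_const ρ M).fun_div h hv.ne').const_mul (Real.exp 1)).log
    (by positivity)).log (by positivity)
  refine hd.congr_deriv ?_
  rw [mul_div_assoc]
  field_simp
  ring

/-- Dividing the derivative of the volume `v` by `v ln (e M / v)` gives, up to sign, the derivative
of `ln ln (e M / v)`, which varies by at most `ln ln (e R)`. -/
theorem volume_lt_deriv_lt_of_le_mul {v : ℝ → ℝ} {a b c m M R : ℝ} (hab : a ≤ b) (hc : 0 < c)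
    (hR : 1 < R) (hm : 0 ≤ m) (hM : M ≤ m * R) (hv : MapsTo v (Icc a b) (Icc m M))
    (hmono : MonotoneOn v (Icc a b) ∨ AntitoneOn v (Icc a b)) :
    volume {ρ ∈ Ioo a b | DifferentiableAt ℝ v ρ ∧
      c * v ρ * Real.log (Real.exp 1 * M / v ρ) * logLog R < |deriv v ρ|}
      < ENNReal.ofReal c⁻¹ := by
  rcases hm.eq_or_lt with rfl | hm
  · have h0 : EqOn v 0 (Icc a b) := fun ρ hρ =>
      le_antisymm ((hv hρ).2.trans (by simpa using hM)) (hv hρ).1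
    rw [sep_eq_empty_iff_mem_false.2, measure_empty, ENNReal.ofReal_pos]
    · exact inv_pos.2 hc
    rintro ρ hρ ⟨-, hbad⟩
    have hd : deriv v ρ = 0 := by
      simpa using (Filter.eventuallyEq_of_mem (Icc_mem_nhds hρ.1 hρ.2) h0).deriv_eq
    simp [hd, h0 (Ioo_subset_Icc_self hρ)] at hbad
  set φ : ℝ → ℝ := fun ρ => logLog (M / v ρ)
  have hpos : MapsTo v (Icc a b) (Ioc 0 M) := fun ρ hρ => ⟨hm.trans_le (hv hρ).1, (hv hρ).2⟩
  have hφ : ∀ ρ ∈ Icc a b, φ ρ ∈ Icc 0 (logLog R) := fun ρ hρ =>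
    logLog_div_mem_Icc hm hM (hv hρ)
  have hφmono : MonotoneOn φ (Icc a b) ∨ AntitoneOn φ (Icc a b) :=
    hmono.symm.imp (fun h => (logLog_div_antitoneOn M).comp h hpos)
      fun h => (logLog_div_antitoneOn M).comp_MonotoneOn h hpos
  have hosc : |φ b - φ a| ≤ logLog R := by
    simpa [Real.dist_eq] using
      Real.dist_le_of_mem_Icc (hφ b (right_mem_Icc.2 hab)) (hφ a (left_mem_Icc.2 hab))
  have hL := logLog_pos hR
  have hlt := volume_lt_abs_deriv_lt hab hφmono (mul_pos hc hL) hL hosc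
  rw [div_mul_cancel_right₀ hL.ne'] at hlt
  refine (measure_mono ?_).trans_lt hlt
  rintro ρ ⟨hρ, hd, hbad⟩
  refine ⟨?_, hρ⟩
  obtain ⟨hv0, hvM⟩ := hpos (Ioo_subset_Icc_self hρ)
  have hlog := one_le_log_exp_one_mul ((one_le_div hv0).2 hvM)
  rw [← mul_div_assoc] at hlog
  rw [mem_ofPred_eq, (hasDerivAt_logLog_div hv0 hvM hd.hasDerivAt).deriv, abs_neg, abs_div,
    abs_of_pos (mul_pos hv0 (by linarith)), lt_div_iff₀ (by positivity)]
  linarith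

end Analysis

theorem sum_union_le {α : Type*} [DecidableEq α] {s t : Finset α} {f : α → ℝ}
    (hf : ∀ a ∈ s ∩ t, 0 ≤ f a) : ∑ a ∈ s ∪ t, f a ≤ ∑ a ∈ s, f a + ∑ a ∈ t, f a := by
  rw [← Finset.sum_union_inter]
  exact le_add_of_nonneg_right (Finset.sum_nonneg hf)

section Length

variable {V : Type*} [DecidableEq V] {r : ℕ}

/-- The length of a walk that `ℓ^i` minimizes: its first node is free of charge. -/
def LPSol.length (p : LPSol V r) (i : Fin r) {G : SimpleGraph V} {u v : V} (P : G.Walk u v) : ℝ :=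
  ∑ e ∈ P.edges.toFinset, p.x e + ∑ w ∈ P.support.toFinset.erase u, p.y i w

variable {I : Problem V r} {p : LPSol V r} {k : ℕ}

theorem Problem.dist_self_le (i : Fin r) (u : V) : I.dist p i u u ≤ 0 := by
  refine (iInf_le _ (SimpleGraph.Path.nil : I.G.Path u u)).trans ?_
  simp

variable [Fintype V] (hp : I.IsFeasible k p)

include hp

namespace Problem.IsFeasible

theorem x_nonneg_of_mem_edges {u v : V} (P : I.G.Walk u v) {e : Sym2 V}
    (he : e ∈ P.edges.toFinset) : 0 ≤ p.x e :=
  hp.x_nonneg e (P.edges_subset_edgeSet (List.mem_toFinset.1 he))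

theorem length_nonneg (i : Fin r) {u v : V} (P : I.G.Walk u v) : 0 ≤ p.length i P :=
  add_nonneg (Finset.sum_nonneg fun _ he => hp.x_nonneg_of_mem_edges P he)
    (Finset.sum_nonneg fun w _ => hp.y_nonneg i w)

theorem length_bypass_le (i : Fin r) {u v : V} (P : I.G.Walk u v) :
    p.length i P.bypass ≤ p.length i P := by
  refine add_le_add
    (Finset.sum_le_sum_of_subset_of_nonneg ?_ fun e he _ => hp.x_nonneg_of_mem_edges P he)
    (Finset.sum_le_sum_of_subset_of_nonneg (Finset.erase_subset_erase u ?_)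
      fun w _ _ => hp.y_nonneg i w)
  · exact fun _ he => List.mem_toFinset.2 (P.edges_bypass_subset_edges (List.mem_toFinset.1 he))
  · exact fun _ hw => List.mem_toFinset.2 (P.support_bypass_subset_support (List.mem_toFinset.1 hw))

theorem length_concat_le (i : Fin r) {u v w : V} (P : I.G.Walk u v) (h : I.G.Adj v w) :
    p.length i (P.concat h) ≤ p.length i P + (p.x s(v, w) + p.y i w) := by
  have hx : ∑ e ∈ (P.concat h).edges.toFinset, p.x e
      ≤ ∑ e ∈ P.edges.toFinset, p.x e + p.x s(v, w) := by
    rw [SimpleGraph.Walk.edges_concat, List.concat_eq_append, List.toFinset_append]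
    simpa using sum_union_le (t := {s(v, w)}) (f := p.x) fun e he =>
      hp.x_nonneg_of_mem_edges P (Finset.mem_inter.1 he).1
  have hy : ∑ a ∈ (P.concat h).support.toFinset.erase u, p.y i a
      ≤ ∑ a ∈ P.support.toFinset.erase u, p.y i a + p.y i w := by
    rw [SimpleGraph.Walk.support_concat, List.toFinset_append, Finset.erase_union_distrib]
    refine (sum_union_le fun a _ => hp.y_nonneg i a).trans (add_le_add_right ?_ _)
    refine (Finset.sum_le_sum_of_subset_of_nonneg (Finset.erase_subset u _)
      fun a _ _ => hp.y_nonneg i a).trans_eq ?_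
    simp
  unfold LPSol.length
  linarith

theorem dist_nonneg (i : Fin r) (u v : V) : 0 ≤ I.dist p i u v :=
  le_iInf fun P => EReal.coe_nonneg.2 (hp.length_nonneg i P.1)

theorem dist_le_length (i : Fin r) {u v : V} (P : I.G.Walk u v) :
    I.dist p i u v ≤ (p.length i P : EReal) :=
  (iInf_le _ P.toPath).trans (EReal.coe_le_coe_iff.2 (hp.length_bypass_le i P))

theorem dist_le_add (i : Fin r) {u v w : V} (h : I.G.Adj v w) :
    I.dist p i u w ≤ I.dist p i u v + ((p.x s(v, w) + p.y i w : ℝ) : EReal) := by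
  rw [← EReal.sub_le_iff_le_add (.inl (EReal.coe_ne_bot _)) (.inl (EReal.coe_ne_top _))]
  refine le_iInf fun P => ?_
  rw [EReal.sub_le_iff_le_add (.inl (EReal.coe_ne_bot _)) (.inl (EReal.coe_ne_top _)),
    ← EReal.coe_add]
  exact (hp.dist_le_length i (P.1.concat h)).trans
    (EReal.coe_le_coe_iff.2 (hp.length_concat_le i P.1 h))

end Problem.IsFeasible

end Length

section Distance

variable {V : Type*} [DecidableEq V] {r : ℕ}

open Classical in
/-- The distance `ℓ^i(z;v)` as a real number, at which `v` is completely inside the ball. A node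
that cannot be reached gets a value above all the radii that occur. -/
noncomputable def Problem.farDist (I : Problem V r) (p : LPSol V r) (i : Fin r) (z v : V) : ℝ :=
  if I.dist p i z v = ⊤ then 2 + p.y i v else (I.dist p i z v).toReal

/-- The distance `ℓ^i(z;v) - y^i_v` at which `v` is entered. -/
noncomputable def Problem.nearDist (I : Problem V r) (p : LPSol V r) (i : Fin r) (z v : V) : ℝ :=
  I.farDist p i z v - p.y i v

variable [Fintype V] {I : Problem V r} {p : LPSol V r} {k : ℕ} (hp : I.IsFeasible k p)

include hp

namespace Problem.IsFeasible

theorem coe_farDist {i : Fin r} {z v : V} (h : I.dist p i z v ≠ ⊤) :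
    (I.farDist p i z v : EReal) = I.dist p i z v := by
  rw [Problem.farDist, if_neg h, EReal.coe_toReal h]
  exact ne_bot_of_le_ne_bot EReal.zero_ne_bot (hp.dist_nonneg i z v)

theorem nearDist_le_farDist (i : Fin r) (z v : V) : I.nearDist p i z v ≤ I.farDist p i z v :=
  sub_le_self _ (hp.y_nonneg i v)

theorem farDist_self (i : Fin r) (z : V) : I.farDist p i z z = 0 := by
  have h0 : I.dist p i z z = 0 := le_antisymm (Problem.dist_self_le i z) (hp.dist_nonneg i z z)
  simp [Problem.farDist, h0]

theorem dist_ne_top_of_adj {i : Fin r} {z u v : V} (h : I.G.Adj u v)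
    (hu : I.dist p i z u ≠ ⊤) : I.dist p i z v ≠ ⊤ := by
  have hle := hp.dist_le_add i (u := z) h
  rw [← hp.coe_farDist hu, ← EReal.coe_add] at hle
  exact ne_top_of_le_ne_top (EReal.coe_ne_top _) hle

theorem nearDist_le_farDist_add (i : Fin r) {z u v : V} (h : I.G.Adj u v) :
    I.nearDist p i z v ≤ I.farDist p i z u + p.x s(u, v) := by
  by_cases hu : I.dist p i z u = ⊤
  · have hv : I.dist p i z v = ⊤ := by
      by_contra hv
      exact hp.dist_ne_top_of_adj h.symm hv hu
    rw [Problem.nearDist, Problem.farDist, Problem.farDist, if_pos hu, if_pos hv]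
    linarith [hp.y_nonneg i u, hp.x_nonneg s(u, v) h]
  · have hle := hp.dist_le_add i (u := z) h
    rw [← hp.coe_farDist hu, ← hp.coe_farDist (hp.dist_ne_top_of_adj h hu), ← EReal.coe_add,
      EReal.coe_le_coe_iff] at hle
    rw [Problem.nearDist]
    linarith

theorem dist_le_coe_iff {i : Fin r} {z v : V} {ρ : ℝ} (hρ : ρ < 2) :
    I.dist p i z v ≤ (ρ : EReal) ↔ I.farDist p i z v ≤ ρ := by
  by_cases h : I.dist p i z v = ⊤
  · rw [Problem.farDist, if_pos h, h]
    simp only [top_le_iff, EReal.coe_ne_top, false_iff, not_le]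
    linarith [hp.y_nonneg i v]
  · rw [← hp.coe_farDist h, EReal.coe_le_coe_iff]

theorem dist_le_coe_add_iff {i : Fin r} {z v : V} {ρ : ℝ} (hρ : ρ < 2) :
    I.dist p i z v ≤ ((ρ + p.y i v : ℝ) : EReal) ↔ I.nearDist p i z v ≤ ρ := by
  rw [Problem.nearDist]
  by_cases h : I.dist p i z v = ⊤
  · rw [Problem.farDist, if_pos h, h]
    simp only [top_le_iff, EReal.coe_ne_top, false_iff, not_le]
    linarith
  · rw [← hp.coe_farDist h, EReal.coe_le_coe_iff, sub_le_iff_le_add]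

theorem one_le_nearDist_sink (i : Fin r) : 1 ≤ I.nearDist p i (I.s i) (I.t i) := by
  rw [Problem.nearDist, hp.y_sink, sub_zero]
  by_cases h : I.dist p i (I.s i) (I.t i) = ⊤
  · rw [Problem.farDist, if_pos h, hp.y_sink]
    norm_num
  · rw [← EReal.coe_le_coe_iff, hp.coe_farDist h]
    refine le_iInf fun P => EReal.coe_le_coe_iff.2 ?_
    rw [Finset.sum_erase _ (hp.y_source i)]
    exact hp.path i P

theorem source_ne_sink (i : Fin r) : I.s i ≠ I.t i := by
  intro h
  have hsink := (hp.one_le_nearDist_sink i).trans (hp.nearDist_le_farDist i (I.s i) (I.t i))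
  rw [← h, hp.farDist_self] at hsink
  norm_num at hsink

end Problem.IsFeasible

end Distance

section Regions

variable {V : Type*} [DecidableEq V] {r : ℕ} {I : Problem V r} {p : LPSol V r} {S : Finset V}
  {i : Fin r} {z : V} {ρ : ℝ}

namespace Problem

theorem ball_subset : I.ball p S i z ρ ⊆ S := Finset.filter_subset _ _

theorem nodeBdry_subset : I.nodeBdry p S i z ρ ⊆ S := Finset.filter_subset _ _

theorem coBall_subset : I.coBall p S i z ρ ⊆ S := Finset.sdiff_subset

variable [Fintype V]

theorem mem_edgesIn {u v : V} : s(u, v) ∈ I.edgesIn S ↔ I.G.Adj u v ∧ u ∈ S ∧ v ∈ S := by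
  simp [edgesIn]

theorem mem_edgesBetween {A B : Finset V} {u v : V} :
    s(u, v) ∈ I.edgesBetween A B ↔ I.G.Adj u v ∧ ((u ∈ A ∧ v ∈ B) ∨ (v ∈ A ∧ u ∈ B)) := by
  simp only [edgesBetween, Finset.mem_filter, Finset.mem_univ, true_and,
    SimpleGraph.mem_edgeSet, Sym2.eq_iff]
  grind

theorem mem_edgeSet_of_mem_edgesIn {e : Sym2 V} (he : e ∈ I.edgesIn S) : e ∈ I.G.edgeSet := by
  classical exact (Finset.mem_filter.1 he).2.1

theorem mem_edgeSet_of_mem_edgesBetween {A B : Finset V} {e : Sym2 V}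
    (he : e ∈ I.edgesBetween A B) : e ∈ I.G.edgeSet := by
  classical exact (Finset.mem_filter.1 he).2.1

theorem edgesIn_mono {S' : Finset V} (h : S ⊆ S') : I.edgesIn S ⊆ I.edgesIn S' := by
  intro e
  induction e with | _ u v
  rw [mem_edgesIn, mem_edgesIn]
  exact fun he => ⟨he.1, h he.2.1, h he.2.2⟩

theorem edgesBetween_mono {A A' B B' : Finset V} (hA : A ⊆ A') (hB : B ⊆ B') :
    I.edgesBetween A B ⊆ I.edgesBetween A' B' := by
  intro e
  induction e with | _ u v
  rw [mem_edgesBetween, mem_edgesBetween]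
  exact fun he => ⟨he.1, he.2.imp (.imp (@hA u) (@hB v)) (.imp (@hA v) (@hB u))⟩

theorem edgesBetween_self : I.edgesBetween S S = I.edgesIn S := by
  ext e
  induction e with | _ u v
  rw [mem_edgesBetween, mem_edgesIn]
  tauto

theorem edgesIn_union_subset_edgesBetween {C D : Finset V} (hD : D.card ≤ 1) :
    I.edgesIn (C ∪ D) ⊆ I.edgesBetween C (C ∪ D) := by
  intro e
  induction e with | _ u v
  rw [mem_edgesIn, mem_edgesBetween]
  rintro ⟨hadj, hu, hv⟩
  have huv : ¬(u ∈ D ∧ v ∈ D) := fun h => hadj.ne (Finset.card_le_one.1 hD u h.1 v h.2)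
  rw [Finset.mem_union] at hu hv
  simp only [Finset.mem_union]
  tauto

/-- The `x`-volume of the edges inside `S`, without the additive term `β` of `𝒱^x(S)`. -/
noncomputable def weight (I : Problem V r) (p : LPSol V r) (S : Finset V) : ℝ :=
  ∑ e ∈ I.edgesIn S, I.c e * p.x e

/-- The common shape of the volumes of balls and of their complements: the edges in `F` count with
their whole length, and the ones that underlie the oriented edges `a ∈ P` with length `g a`. -/
noncomputable def regionVol (I : Problem V r) (p : LPSol V r) (F : Finset (Sym2 V))
    (P : Finset (V × V)) (g : V × V → ℝ) : ℝ :=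
  I.beta p + ∑ e ∈ F, I.c e * p.x e + ∑ a ∈ P, I.c s(a.1, a.2) * g a

theorem regionVol_empty (F : Finset (Sym2 V)) (g : V × V → ℝ) :
    I.regionVol p F ∅ g = I.beta p + ∑ e ∈ F, I.c e * p.x e := by
  simp [regionVol]

theorem hasDerivAt_regionVol {F : Finset (Sym2 V)} {P : Finset (V × V)} {g : ℝ → V × V → ℝ}
    {g' : V × V → ℝ} (hg : ∀ a ∈ P, HasDerivAt (g · a) (g' a) ρ) :
    HasDerivAt (fun ρ' => I.regionVol p F P (g ρ')) (∑ a ∈ P, I.c s(a.1, a.2) * g' a) ρ :=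
  (HasDerivAt.fun_sum fun a ha => (hg a ha).const_mul _).const_add _

end Problem

variable [Fintype V] {k : ℕ} (hp : I.IsFeasible k p)

include hp

namespace Problem.IsFeasible

theorem cost_mul_x_nonneg {e : Sym2 V} (he : e ∈ I.G.edgeSet) : 0 ≤ I.c e * p.x e :=
  mul_nonneg (I.c_nonneg e he) (hp.x_nonneg e he)

theorem weight_nonneg (S : Finset V) : 0 ≤ I.weight p S :=
  Finset.sum_nonneg fun _ he => hp.cost_mul_x_nonneg (mem_edgeSet_of_mem_edgesIn he)

theorem weight_mono {S S' : Finset V} (h : S ⊆ S') : I.weight p S ≤ I.weight p S' :=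
  Finset.sum_le_sum_of_subset_of_nonneg (edgesIn_mono h)
    fun _ he _ => hp.cost_mul_x_nonneg (mem_edgeSet_of_mem_edgesIn he)

theorem beta_nonneg : 0 ≤ I.beta p :=
  div_nonneg (hp.weight_nonneg Finset.univ) (Nat.cast_nonneg r)

theorem volSet_le (hr : r ≠ 0) (S : Finset V) : I.volSet p S ≤ I.beta p * ((r : ℝ) + 1) := by
  have hβ : I.beta p * r = I.value p := div_mul_cancel₀ _ (Nat.cast_ne_zero.2 hr)
  have hS : I.volSet p S = I.beta p + I.weight p S := rfl
  have hle : I.weight p S ≤ I.value p := hp.weight_mono (Finset.subset_univ S)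
  linarith

theorem regionVol_le_regionVol {F F' : Finset (Sym2 V)} {P P' : Finset (V × V)}
    {g g' : V × V → ℝ} (hF : F ⊆ F') (hF' : ∀ e ∈ F', e ∈ I.G.edgeSet)
    (hP : Set.InjOn (fun a : V × V => s(a.1, a.2)) P)
    (hP' : ∀ a ∈ P', I.G.Adj a.1 a.2 ∧ 0 ≤ g' a)
    (h : ∀ a ∈ P, (a ∈ P' ∧ g a ≤ g' a) ∨
      (s(a.1, a.2) ∈ F' \ F ∧ g a ≤ p.x s(a.1, a.2))) :
    I.regionVol p F P g ≤ I.regionVol p F' P' g' := by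
  classical
  set Q : Finset (V × V) := P.filter fun a => a ∈ P' ∧ g a ≤ g' a
  set Q' : Finset (V × V) := P.filter fun a => ¬(a ∈ P' ∧ g a ≤ g' a)
  have hkeep : ∑ a ∈ Q, I.c s(a.1, a.2) * g a ≤ ∑ a ∈ P', I.c s(a.1, a.2) * g' a := calc
    _ ≤ ∑ a ∈ Q, I.c s(a.1, a.2) * g' a := Finset.sum_le_sum fun a ha => by
        obtain ⟨-, haP', hle⟩ := Finset.mem_filter.1 ha
        exact mul_le_mul_of_nonneg_left hle (I.c_nonneg _ (hP' a haP').1)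
    _ ≤ _ := Finset.sum_le_sum_of_subset_of_nonneg (fun a ha => (Finset.mem_filter.1 ha).2.1)
        fun a ha _ => mul_nonneg (I.c_nonneg _ (hP' a ha).1) (hP' a ha).2
  have hfull : ∀ a ∈ Q', s(a.1, a.2) ∈ F' \ F ∧ g a ≤ p.x s(a.1, a.2) := fun a ha =>
    (h a (Finset.mem_filter.1 ha).1).resolve_left (Finset.mem_filter.1 ha).2
  have hmem : ∀ e ∈ F' \ F, e ∈ I.G.edgeSet := fun e he => hF' e (Finset.mem_sdiff.1 he).1
  have hswallow : ∑ a ∈ Q', I.c s(a.1, a.2) * g a ≤ ∑ e ∈ F' \ F, I.c e * p.x e := calc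
    _ ≤ ∑ a ∈ Q', I.c s(a.1, a.2) * p.x s(a.1, a.2) := Finset.sum_le_sum fun a ha =>
        mul_le_mul_of_nonneg_left (hfull a ha).2 (I.c_nonneg _ (hmem _ (hfull a ha).1))
    _ = ∑ e ∈ Q'.image fun a => s(a.1, a.2), I.c e * p.x e :=
        (Finset.sum_image (f := fun e => I.c e * p.x e)
          (hP.mono (Finset.coe_subset.2 (Finset.filter_subset _ P)))).symm
    _ ≤ _ := Finset.sum_le_sum_of_subset_of_nonneg
        (Finset.image_subset_iff.2 fun a ha => (hfull a ha).1)
        fun e he _ => hp.cost_mul_x_nonneg (hmem e he)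
  have hsplit : ∑ a ∈ Q, I.c s(a.1, a.2) * g a + ∑ a ∈ Q', I.c s(a.1, a.2) * g a
      = ∑ a ∈ P, I.c s(a.1, a.2) * g a := Finset.sum_filter_add_sum_filter_not P _ _
  have hsdiff := Finset.sum_sdiff hF (f := fun e => I.c e * p.x e)
  unfold Problem.regionVol
  linarith

theorem regionVol_add_weight_sdiff_le {C D : Finset V} {P : Finset (V × V)} {g : V × V → ℝ}
    (hCS : C ⊆ S) (hDS : D ⊆ S) (hP : Set.InjOn (fun a : V × V => s(a.1, a.2)) P)
    (h : ∀ a ∈ P, s(a.1, a.2) ∈ I.edgesIn S \ I.edgesBetween C D ∧ (a.1 ∈ C ∨ a.2 ∈ C) ∧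
      g a ≤ p.x s(a.1, a.2)) :
    I.regionVol p (I.edgesBetween C D) P g + I.weight p (S \ C) ≤ I.volSet p S := by
  have hrest : ∀ u v, s(u, v) ∈ I.edgesIn S → (u ∈ C ∨ v ∈ C) →
      s(u, v) ∈ I.edgesIn S \ I.edgesIn (S \ C) := fun u v he huv => by
    simp only [Finset.mem_sdiff, mem_edgesIn] at he ⊢
    tauto
  have hle : I.regionVol p (I.edgesBetween C D) P g
      ≤ I.regionVol p (I.edgesIn S \ I.edgesIn (S \ C)) ∅ g := by
    refine hp.regionVol_le_regionVol ?_
      (fun e he => mem_edgeSet_of_mem_edgesIn (Finset.mem_sdiff.1 he).1) hP (by simp)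
      fun a ha => .inr ?_
    · intro e he
      have heS := edgesBetween_mono hCS hDS he
      rw [edgesBetween_self] at heS
      induction e with | _ u v
      exact hrest u v heS ((mem_edgesBetween.1 he).2.imp And.left And.left)
    · obtain ⟨he, hC, hx⟩ := h a ha
      rw [Finset.mem_sdiff] at he
      exact ⟨Finset.mem_sdiff.2 ⟨hrest _ _ he.1 hC, he.2⟩, hx⟩
  have hsdiff := Finset.sum_sdiff (I.edgesIn_mono (Finset.sdiff_subset (s := S) (t := C)))
    (f := fun e => I.c e * p.x e)
  rw [regionVol_empty] at hle
  unfold Problem.volSet Problem.weight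
  linarith

end Problem.IsFeasible

end Regions

section Balls

variable {V : Type*} [Fintype V] [DecidableEq V] {r : ℕ} {I : Problem V r} {p : LPSol V r} {k : ℕ}
  {S : Finset V} {i : Fin r} {z : V} {ρ : ℝ} (hp : I.IsFeasible k p) (hρ : ρ < 2)

include hp hρ

namespace Problem.IsFeasible

theorem mem_ball {v : V} : v ∈ I.ball p S i z ρ ↔ v ∈ S ∧ I.farDist p i z v ≤ ρ := by
  rw [Problem.ball, Finset.mem_filter, hp.dist_le_coe_iff hρ]

theorem mem_nodeBdry {v : V} :
    v ∈ I.nodeBdry p S i z ρ ↔ v ∈ S ∧ ρ < I.farDist p i z v ∧ I.nearDist p i z v ≤ ρ := by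
  rw [Problem.nodeBdry, Finset.mem_filter, ← not_le, hp.dist_le_coe_iff hρ,
    hp.dist_le_coe_add_iff hρ, not_le]

theorem mem_ball_union_nodeBdry {v : V} :
    v ∈ I.ball p S i z ρ ∪ I.nodeBdry p S i z ρ ↔ v ∈ S ∧ I.nearDist p i z v ≤ ρ := by
  rw [Finset.mem_union, hp.mem_ball hρ, hp.mem_nodeBdry hρ]
  grind [hp.nearDist_le_farDist i z v]

theorem mem_coBall {v : V} : v ∈ I.coBall p S i z ρ ↔ v ∈ S ∧ ρ < I.nearDist p i z v := by
  rw [Problem.coBall, Finset.mem_sdiff, hp.mem_ball_union_nodeBdry hρ]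
  grind

theorem mem_coBall_union_nodeBdry {v : V} :
    v ∈ I.coBall p S i z ρ ∪ I.nodeBdry p S i z ρ ↔ v ∈ S ∧ ρ < I.farDist p i z v := by
  rw [Finset.mem_union, hp.mem_coBall hρ, hp.mem_nodeBdry hρ]
  grind [hp.nearDist_le_farDist i z v]

theorem mem_bdryPairs {a : V × V} :
    a ∈ I.bdryPairs p S i z ρ ↔ I.G.Adj a.1 a.2 ∧ a.1 ∈ S ∧ a.2 ∈ S ∧
      I.farDist p i z a.1 ≤ ρ ∧ ρ < I.nearDist p i z a.2 := by
  simp only [Problem.bdryPairs, Finset.mem_filter, Finset.mem_univ, true_and,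
    hp.dist_le_coe_iff hρ]
  rw [← not_le, hp.dist_le_coe_add_iff hρ, not_le]

theorem injOn_bdryPairs :
    Set.InjOn (fun a : V × V => s(a.1, a.2)) (I.bdryPairs p S i z ρ : Set (V × V)) := by
  rintro ⟨u, v⟩ h ⟨u', v'⟩ h' heq
  rw [Finset.mem_coe, hp.mem_bdryPairs hρ] at h h'
  rcases Sym2.eq_iff.1 heq with ⟨rfl, rfl⟩ | ⟨rfl, rfl⟩
  · rfl
  · linarith [h.2.2.2.2, h'.2.2.2.1, hp.nearDist_le_farDist i z v]

theorem cost_edgeBdry :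
    I.cost (I.edgeBdry p S i z ρ) = ∑ a ∈ I.bdryPairs p S i z ρ, I.c s(a.1, a.2) := by
  rw [Problem.cost, Problem.edgeBdry, Finset.sum_image (hp.injOn_bdryPairs hρ)]

theorem edgeBdry_subset : I.edgeBdry p S i z ρ ⊆ I.edgesIn S := by
  refine Finset.image_subset_iff.2 fun a ha => mem_edgesIn.2 ?_
  obtain ⟨hadj, h1, h2, -⟩ := (hp.mem_bdryPairs hρ).1 ha
  exact ⟨hadj, h1, h2⟩

theorem cost_edgeBdry_nonneg : 0 ≤ I.cost (I.edgeBdry p S i z ρ) :=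
  Finset.sum_nonneg fun e he =>
    I.c_nonneg e (mem_edgeSet_of_mem_edgesIn (hp.edgeBdry_subset hρ he))

theorem vol_eq_regionVol :
    I.vol p S i z ρ = I.regionVol p
      (I.edgesBetween (I.ball p S i z ρ) (I.ball p S i z ρ ∪ I.nodeBdry p S i z ρ))
      (I.bdryPairs p S i z ρ) fun a => ρ - I.farDist p i z a.1 := by
  refine congrArg _ (Finset.sum_congr rfl fun a ha => ?_)
  have hle := ((hp.mem_bdryPairs hρ).1 ha).2.2.2.1
  rw [← hp.dist_le_coe_iff hρ] at hle
  simp only [Problem.farDist, if_neg (ne_top_of_le_ne_top (EReal.coe_ne_top _) hle)]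

theorem coVol_eq_regionVol :
    I.coVol p S i z ρ = I.regionVol p
      (I.edgesBetween (I.coBall p S i z ρ) (I.coBall p S i z ρ ∪ I.nodeBdry p S i z ρ))
      (I.bdryPairs p S i z ρ) fun a => I.nearDist p i z a.2 - ρ := by
  refine congrArg _ (Finset.sum_congr rfl fun a ha => ?_)
  obtain ⟨hadj, -, -, hle, -⟩ := (hp.mem_bdryPairs hρ).1 ha
  rw [← hp.dist_le_coe_iff hρ] at hle
  have htop := hp.dist_ne_top_of_adj hadj (ne_top_of_le_ne_top (EReal.coe_ne_top _) hle)
  simp only [Problem.nearDist, Problem.farDist, if_neg htop, sub_right_comm]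

theorem mem_sdiff_ballEdges {a : V × V} (ha : a ∈ I.bdryPairs p S i z ρ) :
    s(a.1, a.2) ∈ I.edgesIn S \
      I.edgesBetween (I.ball p S i z ρ) (I.ball p S i z ρ ∪ I.nodeBdry p S i z ρ) := by
  obtain ⟨hadj, h1, h2, hfar, hnear⟩ := (hp.mem_bdryPairs hρ).1 ha
  rw [Finset.mem_sdiff, mem_edgesIn, mem_edgesBetween, hp.mem_ball hρ, hp.mem_ball hρ,
    hp.mem_ball_union_nodeBdry hρ, hp.mem_ball_union_nodeBdry hρ]
  grind [hp.nearDist_le_farDist i z a.2]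

theorem mem_sdiff_coBallEdges {a : V × V} (ha : a ∈ I.bdryPairs p S i z ρ) :
    s(a.1, a.2) ∈ I.edgesIn S \
      I.edgesBetween (I.coBall p S i z ρ) (I.coBall p S i z ρ ∪ I.nodeBdry p S i z ρ) := by
  obtain ⟨hadj, h1, h2, hfar, hnear⟩ := (hp.mem_bdryPairs hρ).1 ha
  rw [Finset.mem_sdiff, mem_edgesIn, mem_edgesBetween, hp.mem_coBall hρ, hp.mem_coBall hρ,
    hp.mem_coBall_union_nodeBdry hρ, hp.mem_coBall_union_nodeBdry hρ]
  grind [hp.nearDist_le_farDist i z a.1]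

theorem beta_add_sum_le_vol {F : Finset (Sym2 V)}
    (hF : F ⊆ I.edgesBetween (I.ball p S i z ρ) (I.ball p S i z ρ ∪ I.nodeBdry p S i z ρ)) :
    I.beta p + ∑ e ∈ F, I.c e * p.x e ≤ I.vol p S i z ρ := by
  rw [hp.vol_eq_regionVol hρ, ← regionVol_empty F 0]
  refine hp.regionVol_le_regionVol hF (fun _ => mem_edgeSet_of_mem_edgesBetween) (by simp)
    (fun a ha => ?_) (by simp)
  obtain ⟨hadj, -, -, hfar, -⟩ := (hp.mem_bdryPairs hρ).1 ha
  exact ⟨hadj, sub_nonneg.2 hfar⟩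

theorem beta_add_sum_le_coVol {F : Finset (Sym2 V)}
    (hF : F ⊆ I.edgesBetween (I.coBall p S i z ρ) (I.coBall p S i z ρ ∪ I.nodeBdry p S i z ρ)) :
    I.beta p + ∑ e ∈ F, I.c e * p.x e ≤ I.coVol p S i z ρ := by
  rw [hp.coVol_eq_regionVol hρ, ← regionVol_empty F 0]
  refine hp.regionVol_le_regionVol hF (fun _ => mem_edgeSet_of_mem_edgesBetween) (by simp)
    (fun a ha => ?_) (by simp)
  obtain ⟨hadj, -, -, -, hnear⟩ := (hp.mem_bdryPairs hρ).1 ha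
  exact ⟨hadj, sub_nonneg.2 hnear.le⟩

theorem vol_add_weight_sdiff_ball_le :
    I.vol p S i z ρ + I.weight p (S \ I.ball p S i z ρ) ≤ I.volSet p S := by
  rw [hp.vol_eq_regionVol hρ]
  refine hp.regionVol_add_weight_sdiff_le ball_subset
    (Finset.union_subset ball_subset nodeBdry_subset) (hp.injOn_bdryPairs hρ) fun a ha => ?_
  obtain ⟨hadj, h1, -, hfar, hnear⟩ := (hp.mem_bdryPairs hρ).1 ha
  refine ⟨hp.mem_sdiff_ballEdges hρ ha, .inl ((hp.mem_ball hρ).2 ⟨h1, hfar⟩), ?_⟩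
  linarith [hp.nearDist_le_farDist_add i (z := z) hadj]

theorem coVol_add_weight_sdiff_coBall_le :
    I.coVol p S i z ρ + I.weight p (S \ I.coBall p S i z ρ) ≤ I.volSet p S := by
  rw [hp.coVol_eq_regionVol hρ]
  refine hp.regionVol_add_weight_sdiff_le coBall_subset
    (Finset.union_subset coBall_subset nodeBdry_subset) (hp.injOn_bdryPairs hρ) fun a ha => ?_
  obtain ⟨hadj, -, h2, hfar, hnear⟩ := (hp.mem_bdryPairs hρ).1 ha
  refine ⟨hp.mem_sdiff_coBallEdges hρ ha, .inr ((hp.mem_coBall hρ).2 ⟨h2, hnear⟩), ?_⟩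
  linarith [hp.nearDist_le_farDist_add i (z := z) hadj]

theorem vol_mem_Icc : I.vol p S i z ρ ∈ Set.Icc (I.beta p) (I.volSet p S) :=
  ⟨by simpa using hp.beta_add_sum_le_vol hρ (Finset.empty_subset _),
    (le_add_of_nonneg_right (hp.weight_nonneg _)).trans (hp.vol_add_weight_sdiff_ball_le hρ)⟩

theorem coVol_mem_Icc : I.coVol p S i z ρ ∈ Set.Icc (I.beta p) (I.volSet p S) :=
  ⟨by simpa using hp.beta_add_sum_le_coVol hρ (Finset.empty_subset _),
    (le_add_of_nonneg_right (hp.weight_nonneg _)).trans (hp.coVol_add_weight_sdiff_coBall_le hρ)⟩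

omit hρ in
theorem monotoneOn_vol : MonotoneOn (I.vol p S i z) (Set.Iio 2) := by
  intro ρ hρ ρ' hρ' h
  rw [Set.mem_Iio] at hρ hρ'
  rw [hp.vol_eq_regionVol hρ, hp.vol_eq_regionVol hρ']
  refine hp.regionVol_le_regionVol (edgesBetween_mono ?_ ?_)
    (fun _ => mem_edgeSet_of_mem_edgesBetween) (hp.injOn_bdryPairs hρ) (fun a ha => ?_)
    fun a ha => ?_
  · exact fun v hv => (hp.mem_ball hρ').2 (((hp.mem_ball hρ).1 hv).imp_right h.trans')
  · exact fun v hv => (hp.mem_ball_union_nodeBdry hρ').2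
      (((hp.mem_ball_union_nodeBdry hρ).1 hv).imp_right h.trans')
  · obtain ⟨hadj, -, -, hfar, -⟩ := (hp.mem_bdryPairs hρ').1 ha
    exact ⟨hadj, sub_nonneg.2 hfar⟩
  · obtain ⟨hadj, h1, h2, hfar, hnear⟩ := (hp.mem_bdryPairs hρ).1 ha
    rcases lt_or_ge ρ' (I.nearDist p i z a.2) with hlt | hge
    · exact .inl ⟨(hp.mem_bdryPairs hρ').2 ⟨hadj, h1, h2, hfar.trans h, hlt⟩, by linarith⟩
    · refine .inr ⟨Finset.mem_sdiff.2 ⟨mem_edgesBetween.2 ⟨hadj, .inl ⟨?_, ?_⟩⟩,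
        (Finset.mem_sdiff.1 (hp.mem_sdiff_ballEdges hρ ha)).2⟩, ?_⟩
      · exact (hp.mem_ball hρ').2 ⟨h1, hfar.trans h⟩
      · exact (hp.mem_ball_union_nodeBdry hρ').2 ⟨h2, hge⟩
      · linarith [hp.nearDist_le_farDist_add i (z := z) hadj]

omit hρ in
theorem antitoneOn_coVol : AntitoneOn (I.coVol p S i z) (Set.Iio 2) := by
  intro ρ' hρ' ρ hρ h
  rw [Set.mem_Iio] at hρ hρ'
  rw [hp.coVol_eq_regionVol hρ, hp.coVol_eq_regionVol hρ']
  refine hp.regionVol_le_regionVol (edgesBetween_mono ?_ ?_)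
    (fun _ => mem_edgeSet_of_mem_edgesBetween) (hp.injOn_bdryPairs hρ) (fun a ha => ?_)
    fun a ha => ?_
  · exact fun v hv => (hp.mem_coBall hρ').2 (((hp.mem_coBall hρ).1 hv).imp_right h.trans_lt)
  · exact fun v hv => (hp.mem_coBall_union_nodeBdry hρ').2
      (((hp.mem_coBall_union_nodeBdry hρ).1 hv).imp_right h.trans_lt)
  · obtain ⟨hadj, -, -, -, hnear⟩ := (hp.mem_bdryPairs hρ').1 ha
    exact ⟨hadj, sub_nonneg.2 hnear.le⟩
  · obtain ⟨hadj, h1, h2, hfar, hnear⟩ := (hp.mem_bdryPairs hρ).1 ha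
    rcases le_or_gt (I.farDist p i z a.1) ρ' with hle | hgt
    · exact .inl ⟨(hp.mem_bdryPairs hρ').2 ⟨hadj, h1, h2, hle, h.trans_lt hnear⟩, by linarith⟩
    · refine .inr ⟨Finset.mem_sdiff.2 ⟨mem_edgesBetween.2 ⟨hadj, .inr ⟨?_, ?_⟩⟩,
        (Finset.mem_sdiff.1 (hp.mem_sdiff_coBallEdges hρ ha)).2⟩, ?_⟩
      · exact (hp.mem_coBall hρ').2 ⟨h2, h.trans_lt hnear⟩
      · exact (hp.mem_coBall_union_nodeBdry hρ').2 ⟨h1, hgt⟩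
      · linarith [hp.nearDist_le_farDist_add i (z := z) hadj]

end Problem.IsFeasible

end Balls

section Derivative

variable {V : Type*} [DecidableEq V] {r : ℕ} {I : Problem V r} {p : LPSol V r} {k : ℕ}
  {S : Finset V} {i : Fin r} {z : V} {ρ : ℝ}

/-- The radii at which the ball or its node-boundary may change. -/
def Problem.breakpoints (I : Problem V r) (p : LPSol V r) (i : Fin r) (z : V) : Set ℝ :=
  Set.range (I.farDist p i z) ∪ Set.range (I.nearDist p i z)

theorem Problem.finite_breakpoints [Finite V] : (I.breakpoints p i z).Finite :=
  (Set.finite_range _).union (Set.finite_range _)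

theorem eventually_le_iff_of_ne {a ρ : ℝ} (h : a ≠ ρ) : ∀ᶠ ρ' in nhds ρ, (a ≤ ρ' ↔ a ≤ ρ) := by
  rcases lt_or_gt_of_ne h with h | h
  · filter_upwards [lt_mem_nhds h] with ρ' h'
    exact iff_of_true h'.le h.le
  · filter_upwards [gt_mem_nhds h] with ρ' h'
    exact iff_of_false h'.not_ge h.not_ge

variable [Fintype V] (hp : I.IsFeasible k p) (hρ : ρ < 2) (hb : ρ ∉ I.breakpoints p i z)

include hp hρ hb

namespace Problem.IsFeasible

theorem eventually_regions_eq :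
    ∀ᶠ ρ' in nhds ρ, ρ' < 2 ∧ I.ball p S i z ρ' = I.ball p S i z ρ ∧
      I.nodeBdry p S i z ρ' = I.nodeBdry p S i z ρ ∧
      I.bdryPairs p S i z ρ' = I.bdryPairs p S i z ρ := by
  have hfar : ∀ᶠ ρ' in nhds ρ, ∀ v, (I.farDist p i z v ≤ ρ' ↔ I.farDist p i z v ≤ ρ) :=
    eventually_all.2 fun v => eventually_le_iff_of_ne fun h => hb (.inl ⟨v, h⟩)
  have hnear : ∀ᶠ ρ' in nhds ρ, ∀ v, (I.nearDist p i z v ≤ ρ' ↔ I.nearDist p i z v ≤ ρ) :=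
    eventually_all.2 fun v => eventually_le_iff_of_ne fun h => hb (.inr ⟨v, h⟩)
  filter_upwards [hfar, hnear, gt_mem_nhds hρ] with ρ' hfar hnear hρ'
  refine ⟨hρ', ?_, ?_, ?_⟩
  · ext v
    rw [hp.mem_ball hρ', hp.mem_ball hρ, hfar]
  · ext v
    rw [hp.mem_nodeBdry hρ', hp.mem_nodeBdry hρ, hnear, ← not_le, hfar, not_le]
  · ext a
    rw [hp.mem_bdryPairs hρ', hp.mem_bdryPairs hρ, hfar, ← not_le, hnear, not_le]

theorem hasDerivAt_vol : HasDerivAt (I.vol p S i z) (I.cost (I.edgeBdry p S i z ρ)) ρ := by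
  have hd := hasDerivAt_regionVol (I := I) (p := p)
    (F := I.edgesBetween (I.ball p S i z ρ) (I.ball p S i z ρ ∪ I.nodeBdry p S i z ρ))
    (P := I.bdryPairs p S i z ρ) fun a _ => (hasDerivAt_id ρ).sub_const (I.farDist p i z a.1)
  simp only [mul_one] at hd
  rw [hp.cost_edgeBdry hρ]
  refine hd.congr_of_eventuallyEq ?_
  filter_upwards [hp.eventually_regions_eq hρ hb (S := S)] with ρ' ⟨hρ', hball, hbdry, hpairs⟩
  rw [hp.vol_eq_regionVol hρ', hball, hbdry, hpairs]
  rfl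

theorem hasDerivAt_coVol :
    HasDerivAt (I.coVol p S i z) (-I.cost (I.edgeBdry p S i z ρ)) ρ := by
  have hd := hasDerivAt_regionVol (I := I) (p := p)
    (F := I.edgesBetween (I.coBall p S i z ρ) (I.coBall p S i z ρ ∪ I.nodeBdry p S i z ρ))
    (P := I.bdryPairs p S i z ρ) fun a _ => (hasDerivAt_id ρ).const_sub (I.nearDist p i z a.2)
  simp only [mul_neg, mul_one, Finset.sum_neg_distrib] at hd
  rw [hp.cost_edgeBdry hρ]
  refine hd.congr_of_eventuallyEq ?_
  filter_upwards [hp.eventually_regions_eq hρ hb (S := S)] with ρ' ⟨hρ', hball, hbdry, hpairs⟩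
  rw [hp.coVol_eq_regionVol hρ', Problem.coBall, hball, hbdry, hpairs]
  rfl

end Problem.IsFeasible

end Derivative

section Radius

open MeasureTheory Set

theorem exists_mem_Ioo_notMem {N A B C : Set ℝ} (hN : N.Finite)
    (hA : volume A < ENNReal.ofReal 4⁻¹) (hB : volume B < ENNReal.ofReal 4⁻¹)
    (hC : volume C ≤ ENNReal.ofReal 2⁻¹) :
    ∃ ρ ∈ Ioo (0 : ℝ) 1, ρ ∉ N ∧ ρ ∉ A ∧ ρ ∉ B ∧ ρ ∉ C := by
  by_contra! hcon
  have hcover : Ioo (0 : ℝ) 1 ⊆ N ∪ (A ∪ B ∪ C) := by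
    intro ρ hρ
    by_contra h
    simp only [mem_union, not_or] at h
    exact h.2.2 (hcon ρ hρ h.1 h.2.1.1 h.2.1.2)
  refine lt_irrefl (1 : ENNReal) ?_
  calc (1 : ENNReal) = volume (Ioo (0 : ℝ) 1) := by simp
    _ ≤ volume N + (volume A + volume B + volume C) :=
      (measure_mono hcover).trans <| (measure_union_le _ _).trans <| add_le_add_right
        ((measure_union_le _ _).trans (add_le_add_left (measure_union_le _ _) _)) _
    _ = volume A + volume B + volume C := by rw [hN.measure_zero, zero_add]
    _ < ENNReal.ofReal 4⁻¹ + ENNReal.ofReal 4⁻¹ + ENNReal.ofReal 2⁻¹ :=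
      ENNReal.add_lt_add_of_lt_of_le (hC.trans_lt ENNReal.ofReal_lt_top).ne
        (ENNReal.add_lt_add hA hB) hC
    _ = 1 := by
      rw [← ENNReal.ofReal_add (by norm_num) (by norm_num),
        ← ENNReal.ofReal_add (by norm_num) (by norm_num)]
      norm_num

variable {V : Type*} [Fintype V] [DecidableEq V] {r : ℕ} {I : Problem V r} {p : LPSol V r}

namespace Problem.IsFeasible

/-- On average over the radii, the node-boundary has at most `∑ y^i_v ≤ 1` nodes. -/
theorem volume_two_le_card_nodeBdry_le (hp : I.IsFeasible 2 p) (S : Finset V) (i : Fin r) (z : V) :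
    volume {ρ | ρ < 2 ∧ 2 ≤ (I.nodeBdry p S i z ρ).card} ≤ ENNReal.ofReal 2⁻¹ := by
  set A : V → Set ℝ := fun v => Ico (I.nearDist p i z v) (I.farDist p i z v)
  have hlen : ∑ v ∈ S, volume (A v) ≤ 1 := calc
    ∑ v ∈ S, volume (A v) = ENNReal.ofReal (∑ v ∈ S, p.y i v) := by
      simp [A, Problem.nearDist, ENNReal.ofReal_sum_of_nonneg fun v _ => hp.y_nonneg i v]
    _ ≤ ENNReal.ofReal (((2 : ℕ) : ℝ) - 1) := ENNReal.ofReal_le_ofReal <|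
      (Finset.sum_le_sum_of_subset_of_nonneg (Finset.subset_univ S)
        fun v _ _ => hp.y_nonneg i v).trans (hp.sum_y i)
    _ = 1 := by norm_num
  have hmarkov := (mul_measure_le_card_filter_mem volume S (fun v _ => measurableSet_Ico) 2).trans
    hlen
  rw [ENNReal.ofReal_inv_of_pos two_pos, ENNReal.ofReal_ofNat, ENNReal.le_inv_iff_mul_le, mul_comm]
  rw [Nat.cast_ofNat] at hmarkov
  refine (mul_le_mul_right (measure_mono ?_) 2).trans hmarkov
  rintro ρ ⟨hρ, hcard⟩
  refine hcard.trans (Finset.card_le_card fun v hv => ?_)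
  obtain ⟨hS, hfar, hnear⟩ := (hp.mem_nodeBdry hρ).1 hv
  rw [Finset.mem_filter]
  exact ⟨hS, hnear, hfar⟩

theorem exists_goodRadius (hp : I.IsFeasible 2 p) (S : Finset V) (i : Fin r) (z : V) :
    ∃ ρ, I.GoodRadius 2 (1 / 2) p S i z ρ := by
  have hlt : ∀ {ρ : ℝ}, ρ ≤ 1 → ρ < 2 := fun hρ => hρ.trans_lt one_lt_two
  have hsub : Icc (0 : ℝ) 1 ⊆ Iio 2 := fun ρ hρ => hlt hρ.2
  have hR : (1 : ℝ) < r + 1 := lt_add_of_pos_left 1 (Nat.cast_pos.2 i.pos)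
  have hM := hp.volSet_le i.pos.ne' S
  have hvol := volume_lt_deriv_lt_of_le_mul zero_le_one four_pos hR hp.beta_nonneg hM
    (fun ρ hρ => hp.vol_mem_Icc (S := S) (i := i) (z := z) (hlt hρ.2))
    (.inl (hp.monotoneOn_vol.mono hsub))
  have hcoVol := volume_lt_deriv_lt_of_le_mul zero_le_one four_pos hR hp.beta_nonneg hM
    (fun ρ hρ => hp.coVol_mem_Icc (S := S) (i := i) (z := z) (hlt hρ.2))
    (.inr (hp.antitoneOn_coVol.mono hsub))
  obtain ⟨ρ, hρ, hb, hA, hB, hC⟩ := exists_mem_Ioo_notMem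
    (Problem.finite_breakpoints (I := I) (p := p) (i := i) (z := z)) hvol hcoVol
    (hp.volume_two_le_card_nodeBdry_le S i z)
  have hρ2 := hlt hρ.2.le
  have hderiv := hp.hasDerivAt_vol (S := S) hρ2 hb
  have hcoDeriv := hp.hasDerivAt_coVol (S := S) hρ2 hb
  have hcost := hp.cost_edgeBdry_nonneg (S := S) (i := i) (z := z) hρ2
  simp only [mem_ofPred_eq, hρ, hρ2, true_and, hderiv.differentiableAt, hderiv.deriv,
    hcoDeriv.differentiableAt, hcoDeriv.deriv, abs_neg, abs_of_nonneg hcost, not_lt, not_le]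
    at hA hB hC
  have hfour : (2 : ℝ) / (1 - 1 / 2) = 4 := by norm_num
  refine ⟨ρ, hρ.1.le, hρ.2, hfour ▸ hA, hfour ▸ hB, hC.trans_eq ?_⟩
  norm_num

end Problem.IsFeasible

end Radius

section Separation

variable {V : Type*} {H H' : SimpleGraph V} {s t : V}

theorem NodeConnected.of_edges {k : ℕ} (P : Fin k → H.Path s t)
    (hP : ∀ a b : Fin k, a ≠ b →
      P a ≠ P b ∧ ∀ v ∈ (P a).1.support, v ∈ (P b).1.support → v = s ∨ v = t)
    (h : ∀ a, ∀ e ∈ (P a).1.edges, e ∈ H'.edgeSet) : NodeConnected H' k s t := by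
  refine ⟨fun a => ⟨(P a).1.transfer H' (h a), (P a).2.transfer (h a)⟩, fun a b hab => ⟨?_, ?_⟩⟩
  · intro heq
    have hsupport := congrArg (fun Q : H'.Path s t => Q.1.support) heq
    simp only [SimpleGraph.Walk.support_transfer] at hsupport
    exact (hP a b hab).1 (Subtype.ext (SimpleGraph.Walk.ext_support hsupport))
  · simpa only [SimpleGraph.Walk.support_transfer] using (hP a b hab).2

theorem NodeConnected.mono {k : ℕ} (hle : H ≤ H') (h : NodeConnected H k s t) :
    NodeConnected H' k s t := by
  obtain ⟨P, hP⟩ := h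
  exact .of_edges P hP fun a _ he =>
    SimpleGraph.edgeSet_mono hle ((P a).1.edges_subset_edgeSet he)

theorem NodeConnected.exists_adj (h : NodeConnected H 2 s t) :
    (∃ v, H.Adj s v) ∧ ∃ v, H.Adj v t := by
  obtain ⟨P, hP⟩ := h
  have hne : s ≠ t := by
    rintro rfl
    exact (hP 0 1 (by decide)).1 ((P 0).loop_eq.trans (P 1).loop_eq.symm)
  have hnil := SimpleGraph.Walk.not_nil_of_ne (p := (P 0).1) hne
  exact ⟨⟨_, SimpleGraph.Walk.adj_snd hnil⟩, ⟨_, SimpleGraph.Walk.adj_penultimate hnil⟩⟩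

theorem induce_induce_le (H : SimpleGraph V) (S X : Set V) :
    ((H.induce S).spanningCoe.induce X).spanningCoe ≤ (H.induce X).spanningCoe :=
  SimpleGraph.map_monotone _ (SimpleGraph.comap_monotone _ (H.spanningCoe_induce_le S))

theorem NodeConnected.mem_of_induce {X : Set V} (h : NodeConnected (H.induce X).spanningCoe 2 s t) :
    s ∈ X ∧ t ∈ X := by
  obtain ⟨⟨u, hu⟩, ⟨v, hv⟩⟩ := h.exists_adj
  rw [SimpleGraph.map_adj] at hu hv
  obtain ⟨⟨_, hs⟩, _, -, rfl, -⟩ := hu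
  obtain ⟨_, ⟨_, ht⟩, -, -, rfl⟩ := hv
  exact ⟨hs, ht⟩

variable {X Y : Set V} (hcov : ∀ u v, H.Adj u v → (u ∈ X ∧ v ∈ X) ∨ (u ∈ Y ∧ v ∈ Y))

include hcov

theorem exists_mem_inter_of_walk {a b : V} (w : H.Walk a b) (ha : a ∈ X) (hb : b ∉ X) :
    ∃ v ∈ w.support, v ∈ X ∩ Y := by
  induction w with
  | nil => exact absurd ha hb
  | @cons a c b h w ih =>
    by_cases hc : c ∈ X
    · obtain ⟨v, hv, hXY⟩ := ih hc hb
      exact ⟨v, List.mem_cons_of_mem a hv, hXY⟩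
    · have hY := (hcov a c h).resolve_left fun hX => hc hX.2
      exact ⟨a, List.mem_cons_self, ha, hY.1⟩

variable (hXY : (X ∩ Y).Subsingleton)

include hXY

theorem support_subset_of_isPath {a b : V} {w : H.Walk a b} (hw : w.IsPath) (ha : a ∈ X)
    (hb : b ∈ X) : ∀ v ∈ w.support, v ∈ X := by
  classical
  intro v hv
  by_contra hvX
  obtain ⟨y, hy, hyXY⟩ := exists_mem_inter_of_walk hcov (w.takeUntil v hv) ha hvX
  obtain ⟨y', hy', hyXY'⟩ := exists_mem_inter_of_walk hcov (w.dropUntil v hv).reverse hb hvX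
  obtain rfl := hXY hyXY hyXY'
  rw [← w.take_spec hv] at hw
  rw [SimpleGraph.Walk.support_reverse, List.mem_reverse] at hy'
  have hne : y ≠ v := fun h => hvX (h ▸ hyXY.1)
  exact hw.ne_of_mem_support_of_append hne hy hy' rfl

theorem NodeConnected.induce_of_mem {k : ℕ} (h : NodeConnected H k s t) (hs : s ∈ X)
    (ht : t ∈ X) : NodeConnected (H.induce X).spanningCoe k s t := by
  obtain ⟨P, hP⟩ := h
  refine .of_edges P hP fun a e he => ?_
  have hsupp := support_subset_of_isPath hcov hXY (P a).2 hs ht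
  induction e with | _ u v
  simpa using ⟨(P a).1.adj_of_mem_edges he, hsupp u ((P a).1.fst_mem_support_of_mem_edges he),
    hsupp v ((P a).1.snd_mem_support_of_mem_edges he)⟩

theorem NodeConnected.induce_or_induce_of_mem (h : NodeConnected H 2 s t) (hs : s ∈ X)
    (ht : t ∈ Y) : NodeConnected (H.induce X).spanningCoe 2 s t ∨
      NodeConnected (H.induce Y).spanningCoe 2 s t := by
  by_cases htX : t ∈ X
  · exact .inl (h.induce_of_mem hcov hXY hs htX)
  obtain ⟨P, hP⟩ := id h
  obtain ⟨y, hy, hyXY⟩ := exists_mem_inter_of_walk hcov (P 0).1 hs htX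
  obtain ⟨y', hy', hyXY'⟩ := exists_mem_inter_of_walk hcov (P 1).1 hs htX
  obtain rfl := hXY hyXY hyXY'
  rcases (hP 0 1 (by decide)).2 y hy hy' with rfl | rfl
  · exact .inr (h.induce_of_mem (fun u v huv => (hcov u v huv).symm) (Set.inter_comm X Y ▸ hXY)
      hyXY.2 ht)
  · exact absurd hyXY.1 htX

theorem NodeConnected.induce_or_induce (h : NodeConnected H 2 s t) :
    NodeConnected (H.induce X).spanningCoe 2 s t ∨
      NodeConnected (H.induce Y).spanningCoe 2 s t := by
  have hcov' : ∀ u v, H.Adj u v → (u ∈ Y ∧ v ∈ Y) ∨ (u ∈ X ∧ v ∈ X) :=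
    fun u v huv => (hcov u v huv).symm
  have hXY' : (Y ∩ X).Subsingleton := Set.inter_comm X Y ▸ hXY
  obtain ⟨⟨s', hs'⟩, ⟨t', ht'⟩⟩ := h.exists_adj
  rcases hcov s s' hs' with ⟨hs, -⟩ | ⟨hs, -⟩ <;> rcases hcov t' t ht' with ⟨-, ht⟩ | ⟨-, ht⟩
  · exact .inl (h.induce_of_mem hcov hXY hs ht)
  · exact h.induce_or_induce_of_mem hcov hXY hs ht
  · exact (h.induce_or_induce_of_mem hcov' hXY' hs ht).symm
  · exact .inr (h.induce_of_mem hcov' hXY' hs ht)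

end Separation

section Loop

variable {V : Type*} [DecidableEq V] {r : ℕ} {I : Problem V r} {p : LPSol V r}
  {k : ℕ} {S U X Y : Finset V} {T : Finset (Fin r)} {i : Fin r} {z : V} {ρ : ℝ}
  {σ σ' : LoopState V} {Z : Finset (Sym2 V)}

namespace Problem

theorem mem_pairsIn : i ∈ I.pairsIn T S ↔ i ∈ T ∧ I.s i ∈ S ∧ I.t i ∈ S := by
  rw [pairsIn, Finset.mem_filter]

theorem pairsIn_subset : I.pairsIn T S ⊆ T := fun _ hi => (mem_pairsIn.1 hi).1

theorem pairsIn_mono (h : X ⊆ Y) : I.pairsIn T X ⊆ I.pairsIn T Y := fun _ hi =>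
  mem_pairsIn.2 ((mem_pairsIn.1 hi).imp_right (.imp (@h _) (@h _)))

/-- The node set `A ∪ Γ` on which the algorithm recurses. -/
noncomputable def part (I : Problem V r) (p : LPSol V r) (T : Finset (Fin r)) (S : Finset V)
    (i : Fin r) (ρ : ℝ) : Finset V :=
  I.carve p T S i ρ ∪ I.nodeBdry p S i (I.s i) ρ

theorem carve_eq_or : I.carve p T S i ρ = I.ball p S i (I.s i) ρ ∨
    I.carve p T S i ρ = I.coBall p S i (I.s i) ρ := by
  unfold carve
  split_ifs <;> simp

theorem carve_subset : I.carve p T S i ρ ⊆ S := by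
  rcases carve_eq_or (I := I) (p := p) (T := T) (S := S) (i := i) (ρ := ρ) with h | h <;> rw [h]
  exacts [ball_subset, coBall_subset]

theorem part_subset : I.part p T S i ρ ⊆ S := Finset.union_subset carve_subset nodeBdry_subset

theorem part_inter_sdiff_carve_subset :
    I.part p T S i ρ ∩ (S \ I.carve p T S i ρ) ⊆ I.nodeBdry p S i (I.s i) ρ := by
  simp only [part]
  grind

variable [Fintype V]

theorem fromEdgeSet_edgesIn :
    SimpleGraph.fromEdgeSet (I.edgesIn S : Set (Sym2 V)) = (I.G.induce S).spanningCoe := by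
  ext u v
  simpa [mem_edgesIn] using fun h _ _ => h.ne

theorem mem_active :
    i ∈ I.active T S ↔ i ∈ T ∧ NodeConnected (I.G.induce S).spanningCoe 2 (I.s i) (I.t i) := by
  simp only [active, Finset.mem_filter, fromEdgeSet_edgesIn]

theorem active_subset_pairsIn : I.active T S ⊆ I.pairsIn T S := fun _ hi =>
  mem_pairsIn.2 ((mem_active.1 hi).imp_right NodeConnected.mem_of_induce)

namespace GoodRadius

theorem card_nodeBdry_le_one (h : I.GoodRadius 2 (1 / 2) p S i z ρ) :
    (I.nodeBdry p S i z ρ).card ≤ 1 := by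
  have hlt := h.card_lt
  norm_num at hlt
  exact hlt

theorem lt_two (h : I.GoodRadius 2 (1 / 2) p S i z ρ) : ρ < 2 := h.lt_one.trans one_lt_two

theorem card_part_inter_le_one (h : I.GoodRadius 2 (1 / 2) p S i (I.s i) ρ) :
    (I.part p T S i ρ ∩ (S \ I.carve p T S i ρ)).card ≤ 1 :=
  (Finset.card_le_card part_inter_sdiff_carve_subset).trans h.card_nodeBdry_le_one

end GoodRadius

namespace IsFeasible

theorem subset_part_or_subset_sdiff (hp : I.IsFeasible k p) (hρ : ρ < 2) {u v : V}
    (he : s(u, v) ∈ I.edgesIn S) (hb : s(u, v) ∉ I.edgeBdry p S i (I.s i) ρ) :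
    (u ∈ I.part p T S i ρ ∧ v ∈ I.part p T S i ρ) ∨
      (u ∈ S \ I.carve p T S i ρ ∧ v ∈ S \ I.carve p T S i ρ) := by
  obtain ⟨hadj, hu, hv⟩ := mem_edgesIn.1 he
  have huv : ¬(I.farDist p i (I.s i) u ≤ ρ ∧ ρ < I.nearDist p i (I.s i) v) := fun h => hb <|
    Finset.mem_image.2 ⟨(u, v), (hp.mem_bdryPairs hρ).2 ⟨hadj, hu, hv, h⟩, rfl⟩
  have hvu : ¬(I.farDist p i (I.s i) v ≤ ρ ∧ ρ < I.nearDist p i (I.s i) u) := fun h => hb <|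
    Finset.mem_image.2 ⟨(v, u), (hp.mem_bdryPairs hρ).2 ⟨hadj.symm, hv, hu, h⟩, Sym2.eq_swap⟩
  have hu' := hp.nearDist_le_farDist i (I.s i) u
  have hv' := hp.nearDist_le_farDist i (I.s i) v
  unfold Problem.part
  rcases carve_eq_or (I := I) (p := p) (T := T) (S := S) (i := i) (ρ := ρ) with h | h <;> rw [h]
  · simp only [hp.mem_ball_union_nodeBdry hρ, Finset.mem_sdiff, hp.mem_ball hρ]
    grind
  · simp only [hp.mem_coBall_union_nodeBdry hρ, Finset.mem_sdiff, hp.mem_coBall hρ]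
    grind

/-- The source lies in the ball and the sink in the complement of ball and node-boundary. -/
theorem separates_carve (hp : I.IsFeasible k p) (hρ0 : 0 ≤ ρ) (hρ1 : ρ < 1)
    (hi : i ∈ I.pairsIn T S) :
    ¬(I.s i ∈ I.part p T S i ρ ∧ I.t i ∈ I.part p T S i ρ) ∧
      (I.s i ∈ I.carve p T S i ρ ∨ I.t i ∈ I.carve p T S i ρ) := by
  have hρ : ρ < 2 := hρ1.trans one_lt_two
  obtain ⟨-, hs, ht⟩ := mem_pairsIn.1 hi
  have hsink := hp.one_le_nearDist_sink i
  have hsource := hp.farDist_self i (I.s i)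
  unfold Problem.part
  rcases carve_eq_or (I := I) (p := p) (T := T) (S := S) (i := i) (ρ := ρ) with h | h <;> rw [h]
  · simp only [hp.mem_ball_union_nodeBdry hρ, hp.mem_ball hρ, hs, ht, true_and]
    grind
  · simp only [hp.mem_coBall_union_nodeBdry hρ, hp.mem_coBall hρ, hs, ht, true_and]
    grind

theorem card_pairsIn_add_le (hp : I.IsFeasible k p) (hXY : (X ∩ Y).card ≤ 1)
    {P : Finset (Fin r)} (hX : I.pairsIn T X ⊆ P) (hY : I.pairsIn T Y ⊆ P) :
    (I.pairsIn T X).card + (I.pairsIn T Y).card ≤ P.card := by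
  have hdisj : Disjoint (I.pairsIn T X) (I.pairsIn T Y) := Finset.disjoint_left.2 fun j hj hj' => by
    rw [mem_pairsIn] at hj hj'
    exact hp.source_ne_sink j (Finset.card_le_one.1 hXY _ (Finset.mem_inter.2 ⟨hj.2.1, hj'.2.1⟩)
      _ (Finset.mem_inter.2 ⟨hj.2.2, hj'.2.2⟩))
  rw [← Finset.card_union_of_disjoint hdisj]
  exact Finset.card_le_card (Finset.union_subset hX hY)

theorem two_mul_card_pairsIn_part_le (hp : I.IsFeasible k p)
    (h : I.GoodRadius 2 (1 / 2) p S i (I.s i) ρ) :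
    2 * (I.pairsIn T (I.part p T S i ρ)).card ≤ T.card := by
  set B := I.ball p S i (I.s i) ρ ∪ I.nodeBdry p S i (I.s i) ρ
  set C := I.coBall p S i (I.s i) ρ ∪ I.nodeBdry p S i (I.s i) ρ
  have hBC : B ∩ C ⊆ I.nodeBdry p S i (I.s i) ρ := by
    simp only [B, C, Problem.coBall]
    grind
  have hsum : (I.pairsIn T B).card + (I.pairsIn T C).card ≤ T.card := hp.card_pairsIn_add_le
    ((Finset.card_le_card hBC).trans h.card_nodeBdry_le_one) pairsIn_subset pairsIn_subset
  by_cases hc : ((I.pairsIn T B).card : ℝ) ≤ (T.card : ℝ) / 2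
  · rw [part, carve, if_pos hc, mul_comm]
    exact_mod_cast (le_div_iff₀ two_pos).1 hc
  · have hlt : T.card < (I.pairsIn T B).card * 2 := by
      exact_mod_cast (div_lt_iff₀ two_pos).1 (not_le.1 hc)
    rw [part, carve, if_neg hc]
    change 2 * (I.pairsIn T C).card ≤ T.card
    lia

theorem card_pairsIn_part_add_le (hp : I.IsFeasible k p)
    (h : I.GoodRadius 2 (1 / 2) p S i (I.s i) ρ) (hi : i ∈ I.pairsIn T S) :
    (I.pairsIn T (I.part p T S i ρ)).card + 1 + (I.pairsIn T (S \ I.carve p T S i ρ)).card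
      ≤ (I.pairsIn T S).card := by
  obtain ⟨hpart, hcarve⟩ := hp.separates_carve h.nonneg h.lt_one hi
  have hsum := hp.card_pairsIn_add_le (T := T) h.card_part_inter_le_one
    (Finset.subset_erase.2 ⟨pairsIn_mono part_subset, fun hm => hpart (mem_pairsIn.1 hm).2⟩)
    (Finset.subset_erase.2 ⟨pairsIn_mono Finset.sdiff_subset, fun hm => hcarve.elim
      (Finset.mem_sdiff.1 (mem_pairsIn.1 hm).2.1).2 (Finset.mem_sdiff.1 (mem_pairsIn.1 hm).2.2).2⟩)
  have herase := Finset.card_erase_add_one hi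
  lia

end IsFeasible

theorem LoopStep.card_lt (hp : I.IsFeasible k p) (h : I.LoopStep p T σ σ') :
    σ'.S.card < σ.S.card := by
  obtain ⟨i, hi, ρ, hρ, rfl⟩ := h
  refine Finset.card_lt_card (Finset.sdiff_ssubset carve_subset ?_)
  rcases (hp.separates_carve hρ.nonneg hρ.lt_one (active_subset_pairsIn hi)).2 with h | h
  exacts [⟨_, h⟩, ⟨_, h⟩]

theorem IsFeasible.wellFounded_loopStep (hp : I.IsFeasible k p) :
    WellFounded fun σ' σ => I.LoopStep p T σ σ' :=
  Subrelation.wf (LoopStep.card_lt hp) (measure fun σ : LoopState V => σ.S.card).wf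

theorem LoopReaches.card_pairsIn_lt (hp : I.IsFeasible k p) (h : I.LoopReaches p U T σ) :
    ∀ A ∈ σ.parts, (I.pairsIn T A).card < T.card := by
  induction h with
  | refl => simp
  | tail _ hstep ih =>
    obtain ⟨i, hi, ρ, hρ, rfl⟩ := hstep
    refine Finset.forall_mem_insert _ _ _ |>.2 ⟨?_, ih⟩
    have hhalf := hp.two_mul_card_pairsIn_part_le hρ (T := T)
    have hT : 0 < T.card := Finset.card_pos.2 ⟨i, (mem_active.1 hi).1⟩
    change (I.pairsIn T (I.part p T _ i ρ)).card < _
    lia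

theorem IsFeasible.halts (hp : I.IsFeasible 2 p) (U : Finset V) (T : Finset (Fin r)) :
    I.Halts p U T := by
  induction hn : T.card using Nat.strong_induction_on generalizing U T with | _ n ih
  exact .mk U T (hp.wellFounded_loopStep.apply _)
    (fun σ _ i _ => hp.exists_goodRadius σ.S i (I.s i))
    fun σ hσ _ A hA => ih _ (hn ▸ hσ.card_pairsIn_lt hp A hA) A _ rfl

theorem IsFeasible.exists_loopReaches_active_eq_empty (hp : I.IsFeasible 2 p)
    (h : I.LoopReaches p U T σ) : ∃ σ', I.LoopReaches p U T σ' ∧ I.active T σ'.S = ∅ := by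
  induction σ using (hp.wellFounded_loopStep (T := T)).induction with | _ σ ih
  rcases (I.active T σ.S).eq_empty_or_nonempty with hdone | ⟨i, hi⟩
  · exact ⟨σ, h, hdone⟩
  · obtain ⟨ρ, hρ⟩ := hp.exists_goodRadius σ.S i (I.s i)
    have hstep : I.LoopStep p T σ (I.next p T σ i ρ) := ⟨i, hi, ρ, hρ, rfl⟩
    exact ih _ hstep (h.tail hstep)

theorem IsFeasible.exists_returns (hp : I.IsFeasible 2 p) (U : Finset V) (T : Finset (Fin r)) :
    ∃ Z, I.Returns p U T Z := by
  induction hn : T.card using Nat.strong_induction_on generalizing U T with | _ n ih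
  obtain ⟨σ, hσ, hdone⟩ := hp.exists_loopReaches_active_eq_empty (U := U) (T := T) .refl
  have hrec : ∀ A, ∃ Z, A ∈ σ.parts → I.Returns p A (I.pairsIn T A) Z := fun A => by
    by_cases hA : A ∈ σ.parts
    · obtain ⟨Z, hZ⟩ := ih _ (hn ▸ hσ.card_pairsIn_lt hp A hA) A (I.pairsIn T A) rfl
      exact ⟨Z, fun _ => hZ⟩
    · exact ⟨∅, fun h => absurd h hA⟩
  choose W hW using hrec
  exact ⟨_, .mk U T σ W hσ hdone hW⟩

theorem LoopReaches.coe_subset_edgeSet (hp : I.IsFeasible k p) (h : I.LoopReaches p U T σ) :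
    (σ.Z : Set (Sym2 V)) ⊆ I.G.edgeSet := by
  induction h with
  | refl => simp
  | tail _ hstep ih =>
    obtain ⟨i, -, ρ, hρ, rfl⟩ := hstep
    simp only [next, Finset.coe_union]
    exact Set.union_subset ih fun e he =>
      mem_edgeSet_of_mem_edgesIn (hp.edgeBdry_subset hρ.lt_two he)

theorem Returns.coe_subset_edgeSet (hp : I.IsFeasible k p) (h : I.Returns p U T Z) :
    (Z : Set (Sym2 V)) ⊆ I.G.edgeSet := by
  induction h with | mk U T σ W reach done _ ih
  simpa using ⟨reach.coe_subset_edgeSet hp, ih⟩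

theorem LoopReaches.nodeConnected_induce (hp : I.IsFeasible k p) (h : I.LoopReaches p U T σ)
    {H : SimpleGraph V} (hH : H ≤ I.G.deleteEdges (σ.Z : Set (Sym2 V))) {s t : V}
    (hc : NodeConnected (H.induce U).spanningCoe 2 s t) :
    NodeConnected (H.induce σ.S).spanningCoe 2 s t ∨
      ∃ A ∈ σ.parts, NodeConnected (H.induce (A : Set V)).spanningCoe 2 s t := by
  induction h with
  | refl => exact .inl hc
  | @tail σ _ _ hstep ih =>
    obtain ⟨i, -, ρ, hρ, rfl⟩ := hstep
    have hZ : H ≤ I.G.deleteEdges (σ.Z : Set (Sym2 V)) :=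
      hH.trans (SimpleGraph.deleteEdges_anti (Finset.coe_subset.2 Finset.subset_union_left))
    rcases ih hZ with hS | ⟨A, hA, hcA⟩
    swap
    · exact .inr ⟨A, Finset.mem_insert_of_mem hA, hcA⟩
    have hcov : ∀ u v, (H.induce σ.S).spanningCoe.Adj u v →
        (u ∈ I.part p T σ.S i ρ ∧ v ∈ I.part p T σ.S i ρ) ∨
          (u ∈ σ.S \ I.carve p T σ.S i ρ ∧ v ∈ σ.S \ I.carve p T σ.S i ρ) := by
      intro u v huv
      obtain ⟨hadj, hu, hv⟩ : H.Adj u v ∧ u ∈ σ.S ∧ v ∈ σ.S := by simpa using huv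
      obtain ⟨hG, hnZ⟩ := SimpleGraph.deleteEdges_adj.1 (hH hadj)
      exact hp.subset_part_or_subset_sdiff hρ.lt_two (mem_edgesIn.2 ⟨hG, hu, hv⟩)
        fun hb => hnZ (Finset.mem_union_right _ hb)
    have hsub : ((I.part p T σ.S i ρ : Set V) ∩
        (σ.S \ I.carve p T σ.S i ρ : Finset V)).Subsingleton := by
      exact_mod_cast Finset.card_le_one_iff_subsingleton.1 hρ.card_part_inter_le_one
    rcases hS.induce_or_induce hcov hsub with hc | hc
    · exact .inr ⟨_, Finset.mem_insert_self _ _, hc.mono (induce_induce_le H _ _)⟩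
    · exact .inl (hc.mono (induce_induce_le H _ _))

theorem Returns.not_nodeConnected (h : I.Returns p U T Z) (hp : I.IsFeasible k p) : ∀ i ∈ T,
    ¬NodeConnected ((I.G.deleteEdges (Z : Set (Sym2 V))).induce U).spanningCoe 2
      (I.s i) (I.t i) := by
  induction h with | mk U T σ W reach done _ ih
  intro i hi hc
  have hmono : ∀ {F : Finset (Sym2 V)}, F ⊆ σ.Z ∪ σ.parts.biUnion W →
      I.G.deleteEdges (σ.Z ∪ σ.parts.biUnion W : Finset (Sym2 V)) ≤ I.G.deleteEdges F :=
    fun hF => SimpleGraph.deleteEdges_anti (Finset.coe_subset.2 hF)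
  rcases reach.nodeConnected_induce hp (hmono Finset.subset_union_left) hc with hS | ⟨A, hA, hcA⟩
  · have hact : i ∈ I.active T σ.S := mem_active.2 ⟨hi, hS.mono (SimpleGraph.map_monotone _
      (SimpleGraph.comap_monotone _ (SimpleGraph.deleteEdges_le _)))⟩
    simp [done] at hact
  · refine ih A hA i (mem_pairsIn.2 ⟨hi, hcA.mem_of_induce⟩) (hcA.mono
      (SimpleGraph.map_monotone _ (SimpleGraph.comap_monotone _ (hmono ?_))))
    exact (Finset.subset_biUnion_of_mem W hA).trans Finset.subset_union_right

end Problem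

end Loop

section Potential

theorem log_add_div_self_nonneg {β w : ℝ} (hβ : 0 ≤ β) (hw : 0 ≤ w) :
    0 ≤ Real.log ((β + w) / β) := by
  rcases hβ.eq_or_lt with rfl | hβ
  · simp
  · exact Real.log_nonneg ((one_le_div hβ).2 (le_add_of_nonneg_right hw))

theorem size_add_one_le {m n : ℕ} (h : 2 * m ≤ n) (hn : 0 < n) : m.size + 1 ≤ n.size := by
  rw [Nat.succ_le_iff, Nat.lt_size]
  rcases m.eq_zero_or_pos with rfl | hm
  · simpa using Nat.succ_le_of_lt hn
  · obtain ⟨j, hj⟩ := Nat.exists_eq_succ_of_ne_zero (Nat.size_pos.2 hm).ne'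
    have hpow : 2 ^ j ≤ m := Nat.lt_size.1 (hj ▸ j.lt_succ_self)
    rw [hj, pow_succ]
    lia

theorem size_le_log {n : ℕ} (hn : 2 ≤ n) : (n.size : ℝ) ≤ 4 * Real.log n := by
  obtain ⟨j, hj⟩ := Nat.exists_eq_succ_of_ne_zero (Nat.size_pos.2 (by lia : 0 < n)).ne'
  have hpow : 2 ^ j ≤ n := Nat.lt_size.1 (hj ▸ j.lt_succ_self)
  have hlog : (j : ℝ) * Real.log 2 ≤ Real.log n := by
    rw [← Real.log_pow]
    exact Real.log_le_log (by positivity) (by exact_mod_cast hpow)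
  have htwo : Real.log 2 ≤ Real.log n := Real.log_le_log two_pos (by exact_mod_cast hn)
  rw [hj]
  push_cast
  nlinarith [Real.log_two_gt_d9]

/-- The price that a call on a node set of weight `w` with `n` pairs charges per unit of volume.
The first summand telescopes along the recursion, the second one bounds its depth. -/
noncomputable def rate (β w : ℝ) (n : ℕ) : ℝ := Real.log ((β + w) / β) + n.size

/-- The bound, up to a constant multiple of `ln ln (e (r + 1))`, on the cost of a call on a node set
of weight `w` with `n` pairs. -/
noncomputable def potential (β w : ℝ) (n : ℕ) : ℝ := (w + n * β) * rate β w n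

theorem rate_nonneg {β w : ℝ} (hβ : 0 ≤ β) (hw : 0 ≤ w) (n : ℕ) : 0 ≤ rate β w n :=
  add_nonneg (log_add_div_self_nonneg hβ hw) (Nat.cast_nonneg _)

theorem potential_nonneg {β w : ℝ} (hβ : 0 ≤ β) (hw : 0 ≤ w) (n : ℕ) : 0 ≤ potential β w n :=
  mul_nonneg (by positivity) (rate_nonneg hβ hw n)

/-- With `a = ln ((β + W) / β)` and `b = ln (v / β)`, the boundary costs at most `v (1 + a - b)`
and the recursive call at most `(v + m β) (b + size n - 1)`, so that `b` cancels. -/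
theorem mul_log_add_potential_le {β v w M W R : ℝ} {m n : ℕ} (hβ : 0 ≤ β) (hw : 0 ≤ w)
    (hv : β + w ≤ v) (hvM : v ≤ M) (hMR : M ≤ β * R) (hMW : M ≤ β + W) (hmn : 2 * m ≤ n)
    (hn : 0 < n) :
    v * Real.log (Real.exp 1 * M / v) + potential β w m ≤ (v + m * β) * rate β W n := by
  rcases hβ.eq_or_lt with rfl | hβ
  · obtain rfl : v = 0 := by linarith
    obtain rfl : w = 0 := by linarith
    simp [potential]
  have hv0 : 0 < v := by linarith
  have hM0 : 0 < M := hv0.trans_le hvM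
  have hmβ : 0 ≤ m * β := by positivity
  have hsize : (m.size : ℝ) + 1 ≤ n.size := by exact_mod_cast size_add_one_le hmn hn
  set a := Real.log ((β + W) / β)
  set b := Real.log (v / β)
  have hwb : Real.log ((β + w) / β) ≤ b := Real.log_le_log (by positivity) (by gcongr)
  have hbdry : Real.log (Real.exp 1 * M / v) ≤ 1 + (a - b) := by
    have hMa : Real.log (M / β) ≤ a := Real.log_le_log (by positivity) (by gcongr)
    rw [Real.log_div hM0.ne' hβ.ne'] at hMa
    rw [Real.log_div (by positivity) hv0.ne', Real.log_mul (Real.exp_ne_zero _) hM0.ne',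
      Real.log_exp]
    linarith [show b = Real.log v - Real.log β from Real.log_div hv0.ne' hβ.ne']
  have hrec : potential β w m ≤ (v + m * β) * (b + (n.size - 1)) :=
    mul_le_mul (by linarith) (add_le_add hwb (by linarith)) (rate_nonneg hβ.le hw m) (by linarith)
  calc v * Real.log (Real.exp 1 * M / v) + potential β w m
      ≤ (v + m * β) * (1 + (a - b)) + (v + m * β) * (b + (n.size - 1)) :=
        add_le_add (mul_le_mul (le_add_of_nonneg_right hmβ) hbdry
          (Real.log_nonneg ?_) (by linarith)) hrec
    _ = (v + m * β) * rate β W n := by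
        unfold rate
        ring
  rw [one_le_div hv0]
  nlinarith [Real.add_one_le_exp (1 : ℝ)]

/-- The approximation factor `f(r)`. -/
noncomputable def factor (r : ℕ) : ℝ := 8 * logLog (r + 1) * (Real.log (r + 1) + r.size)

theorem factor_isBigO :
    factor =O[atTop] fun r : ℕ => Real.log (r : ℝ) * Real.log (Real.log (r : ℝ)) := by
  refine IsBigO.of_bound 96 ?_
  have hlog : Tendsto (fun r : ℕ => Real.log (r : ℝ)) atTop atTop :=
    Real.tendsto_log_atTop.comp tendsto_natCast_atTop_atTop
  filter_upwards [hlog.eventually_ge_atTop 3, eventually_ge_atTop 2] with r hlog3 hr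
  have hr2 : (2 : ℝ) ≤ r := by exact_mod_cast hr
  have hsucc : (1 : ℝ) ≤ r + 1 := by linarith
  have hlogLog_nonneg := logLog_nonneg hsucc
  have hlogSucc_nonneg := Real.log_nonneg hsucc
  have hlogSucc : Real.log ((r : ℝ) + 1) ≤ 2 * Real.log r := by
    rw [two_mul, ← Real.log_mul (by linarith) (by linarith)]
    exact Real.log_le_log (by linarith) (by nlinarith)
  have hlogLog : logLog (r + 1) ≤ 2 * Real.log (Real.log r) := by
    rw [logLog, two_mul, ← Real.log_mul (by linarith) (by linarith),
      Real.log_mul (Real.exp_ne_zero _) (by positivity), Real.log_exp]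
    exact Real.log_le_log (by linarith) (by nlinarith)
  have hfactor : 0 ≤ factor r := by
    unfold factor
    positivity
  have hloglog : 0 ≤ Real.log (Real.log r) := Real.log_nonneg (by linarith)
  rw [Real.norm_of_nonneg hfactor, Real.norm_of_nonneg (mul_nonneg (by linarith) hloglog)]
  calc factor r ≤ 8 * (2 * Real.log (Real.log r)) * (2 * Real.log r + 4 * Real.log r) := by
        unfold factor
        gcongr
        exact size_le_log hr
    _ = 96 * (Real.log r * Real.log (Real.log r)) := by ring

end Potential

section Cost

variable {V : Type*} [DecidableEq V] {r k : ℕ} {I : Problem V r} {p : LPSol V r}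
  {S U : Finset V} {T : Finset (Fin r)} {i : Fin r} {ρ : ℝ} {σ σ' : LoopState V}
  {Z : Finset (Sym2 V)}

namespace Problem

theorem cost_union_le {F F' : Finset (Sym2 V)} (hF : (F : Set (Sym2 V)) ⊆ I.G.edgeSet) :
    I.cost (F ∪ F') ≤ I.cost F + I.cost F' :=
  sum_union_le fun e he => I.c_nonneg e (hF (Finset.mem_of_mem_inter_left he))

theorem cost_biUnion_le {ι : Type*} {P : Finset ι} {W : ι → Finset (Sym2 V)}
    (hW : ∀ a ∈ P, (W a : Set (Sym2 V)) ⊆ I.G.edgeSet) :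
    I.cost (P.biUnion W) ≤ ∑ a ∈ P, I.cost (W a) := by
  classical
  induction P using Finset.induction_on with
  | empty => simp [cost]
  | insert a P ha ih =>
    rw [Finset.forall_mem_insert] at hW
    rw [Finset.biUnion_insert, Finset.sum_insert ha]
    exact (cost_union_le hW.1).trans (add_le_add_right (ih hW.2) _)

variable [Fintype V]

/-- The volume `v` is the one of the side of the cut that is carved out. -/
theorem GoodRadius.exists_volume (h : I.GoodRadius 2 (1 / 2) p S i (I.s i) ρ)
    (hp : I.IsFeasible k p) (T : Finset (Fin r)) :
    ∃ v, I.beta p + I.weight p (I.part p T S i ρ) ≤ v ∧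
      v + I.weight p (S \ I.carve p T S i ρ) ≤ I.volSet p S ∧
      I.cost (I.edgeBdry p S i (I.s i) ρ) ≤
        4 * logLog (r + 1) * (v * Real.log (Real.exp 1 * I.volSet p S / v)) := by
  have hfour : (2 : ℝ) / (1 - 1 / 2) = 4 := by norm_num
  have hedges := fun C : Finset V => edgesIn_union_subset_edgesBetween (I := I) (C := C)
    h.card_nodeBdry_le_one
  unfold part
  rcases carve_eq_or (I := I) (p := p) (T := T) (S := S) (i := i) (ρ := ρ) with hc | hc <;> rw [hc]
  · refine ⟨I.vol p S i (I.s i) ρ, hp.beta_add_sum_le_vol h.lt_two (hedges _),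
      hp.vol_add_weight_sdiff_ball_le h.lt_two, h.cost_le_vol.trans_eq ?_⟩
    rw [hfour, logLog]
    ring
  · refine ⟨I.coVol p S i (I.s i) ρ, hp.beta_add_sum_le_coVol h.lt_two (hedges _),
      hp.coVol_add_weight_sdiff_coBall_le h.lt_two, h.cost_le_coVol.trans_eq ?_⟩
    rw [hfour, logLog]
    ring

/-- The bound on the cost of a call on the node set `U` and the pairs in `T`. -/
noncomputable def callBound (I : Problem V r) (p : LPSol V r) (U : Finset V)
    (T : Finset (Fin r)) : ℝ :=
  4 * logLog (r + 1) * potential (I.beta p) (I.weight p U) T.card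

/-- What remains of the budget of a call on `(U, T)` once the loop has shrunk the node set to `S`:
the edges and the pairs inside `S` have not been charged yet. -/
noncomputable def reserve (I : Problem V r) (p : LPSol V r) (U : Finset V) (T : Finset (Fin r))
    (S : Finset V) : ℝ :=
  4 * logLog (r + 1) * ((I.weight p S + (I.pairsIn T S).card * I.beta p)
    * rate (I.beta p) (I.weight p U) T.card)

/-- The cost of the edges that a call on `(U, T)` has bought, together with the bounds on the
recursive calls it has already committed itself to and with its reserve. -/
noncomputable def amortizedCost (I : Problem V r) (p : LPSol V r) (U : Finset V)
    (T : Finset (Fin r)) (σ : LoopState V) : ℝ :=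
  I.cost σ.Z + ∑ A ∈ σ.parts, I.callBound p A (I.pairsIn T A) + I.reserve p U T σ.S

theorem four_mul_logLog_nonneg (r : ℕ) : 0 ≤ 4 * logLog (r + 1) :=
  mul_nonneg zero_le_four (logLog_nonneg (le_add_of_nonneg_left r.cast_nonneg))

namespace IsFeasible

theorem callBound_nonneg (hp : I.IsFeasible k p) (U : Finset V) (T : Finset (Fin r)) :
    0 ≤ I.callBound p U T :=
  mul_nonneg (four_mul_logLog_nonneg r) (potential_nonneg hp.beta_nonneg (hp.weight_nonneg U) _)

theorem reserve_nonneg (hp : I.IsFeasible k p) (U : Finset V) (T : Finset (Fin r)) (S : Finset V) :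
    0 ≤ I.reserve p U T S :=
  mul_nonneg (four_mul_logLog_nonneg r) <| mul_nonneg
    (add_nonneg (hp.weight_nonneg S) (mul_nonneg (Nat.cast_nonneg _) hp.beta_nonneg))
    (rate_nonneg hp.beta_nonneg (hp.weight_nonneg U) _)

theorem reserve_self_le_callBound (hp : I.IsFeasible k p) (U : Finset V) (T : Finset (Fin r)) :
    I.reserve p U T U ≤ I.callBound p U T := by
  have hcard : ((I.pairsIn T U).card : ℝ) ≤ T.card := by
    exact_mod_cast Finset.card_le_card (pairsIn_subset (I := I))
  exact mul_le_mul_of_nonneg_left (mul_le_mul_of_nonneg_right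
    (add_le_add_right (mul_le_mul_of_nonneg_right hcard hp.beta_nonneg) _)
    (rate_nonneg hp.beta_nonneg (hp.weight_nonneg U) _)) (four_mul_logLog_nonneg r)

theorem cost_edgeBdry_add_callBound_add_reserve_le (hp : I.IsFeasible k p) (hSU : S ⊆ U)
    (hi : i ∈ I.active T S) (h : I.GoodRadius 2 (1 / 2) p S i (I.s i) ρ) :
    I.cost (I.edgeBdry p S i (I.s i) ρ)
        + I.callBound p (I.part p T S i ρ) (I.pairsIn T (I.part p T S i ρ))
        + I.reserve p U T (S \ I.carve p T S i ρ)
      ≤ I.reserve p U T S := by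
  obtain ⟨v, hv, hvS, hcost⟩ := h.exists_volume hp T
  set A := I.part p T S i ρ
  set S' := S \ I.carve p T S i ρ
  have hβ := hp.beta_nonneg
  have hpairs : ((I.pairsIn T A).card : ℝ) + 1 + (I.pairsIn T S').card ≤ (I.pairsIn T S).card := by
    exact_mod_cast hp.card_pairsIn_part_add_le h (active_subset_pairsIn hi)
  have hvol : I.volSet p S = I.beta p + I.weight p S := rfl
  have hpay := mul_log_add_potential_le (W := I.weight p U) hβ (hp.weight_nonneg A) hv
    (by linarith [hp.weight_nonneg S']) (hp.volSet_le i.pos.ne' S)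
    (by linarith [hp.weight_mono hSU]) (hp.two_mul_card_pairsIn_part_le h)
    (Finset.card_pos.2 ⟨i, (mem_active.1 hi).1⟩)
  have hcharge : v + (I.pairsIn T A).card * I.beta p + (I.weight p S' + (I.pairsIn T S').card
      * I.beta p) ≤ I.weight p S + (I.pairsIn T S).card * I.beta p := by
    linarith [mul_le_mul_of_nonneg_right hpairs hβ]
  have hrate := rate_nonneg hβ (hp.weight_nonneg U) T.card
  have hscale := mul_le_mul_of_nonneg_left (hpay.trans (mul_le_mul_of_nonneg_right
    (le_sub_iff_add_le.2 hcharge) hrate)) (four_mul_logLog_nonneg r)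
  unfold callBound reserve
  linarith

end IsFeasible

theorem LoopReaches.subset (h : I.LoopReaches p U T σ) : σ.S ⊆ U := by
  induction h with
  | refl => exact subset_rfl
  | tail _ hstep ih =>
    obtain ⟨i, -, ρ, -, rfl⟩ := hstep
    exact Finset.sdiff_subset.trans ih

theorem LoopStep.amortizedCost_le (h : I.LoopStep p T σ σ') (hp : I.IsFeasible k p)
    (hSU : σ.S ⊆ U) (hZ : (σ.Z : Set (Sym2 V)) ⊆ I.G.edgeSet) :
    I.amortizedCost p U T σ' ≤ I.amortizedCost p U T σ := by
  obtain ⟨i, hi, ρ, hρ, rfl⟩ := h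
  set A := I.part p T σ.S i ρ
  have hparts : ∑ B ∈ insert A σ.parts, I.callBound p B (I.pairsIn T B)
      ≤ I.callBound p A (I.pairsIn T A) + ∑ B ∈ σ.parts, I.callBound p B (I.pairsIn T B) := by
    rw [Finset.insert_eq]
    exact (sum_union_le fun B _ => hp.callBound_nonneg B _).trans_eq
      (congrArg (· + _) (Finset.sum_singleton _ _))
  calc I.amortizedCost p U T (I.next p T σ i ρ)
      ≤ I.cost σ.Z + I.cost (I.edgeBdry p σ.S i (I.s i) ρ)
        + (I.callBound p A (I.pairsIn T A) + ∑ B ∈ σ.parts, I.callBound p B (I.pairsIn T B))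
        + I.reserve p U T (σ.S \ I.carve p T σ.S i ρ) :=
        add_le_add_left (add_le_add (cost_union_le hZ) hparts) _
    _ ≤ I.amortizedCost p U T σ := by
        unfold amortizedCost
        linarith [hp.cost_edgeBdry_add_callBound_add_reserve_le hSU hi hρ]

theorem LoopReaches.amortizedCost_le (h : I.LoopReaches p U T σ) (hp : I.IsFeasible k p) :
    I.amortizedCost p U T σ ≤ I.callBound p U T := by
  induction h with
  | refl => simpa [amortizedCost, cost] using hp.reserve_self_le_callBound U T
  | tail hreach hstep ih =>
    have hreach : I.LoopReaches p U T _ := hreach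
    exact (hstep.amortizedCost_le hp hreach.subset (hreach.coe_subset_edgeSet hp)).trans ih

theorem Returns.cost_le (h : I.Returns p U T Z) (hp : I.IsFeasible k p) :
    I.cost Z ≤ I.callBound p U T := by
  induction h with | mk U T σ W reach _ hrec ih
  calc I.cost (σ.Z ∪ σ.parts.biUnion W)
      ≤ I.cost σ.Z + ∑ A ∈ σ.parts, I.cost (W A) :=
        (cost_union_le (reach.coe_subset_edgeSet hp)).trans <| add_le_add_right
          (cost_biUnion_le fun A hA => (hrec A hA).coe_subset_edgeSet hp) _
    _ ≤ I.cost σ.Z + ∑ A ∈ σ.parts, I.callBound p A (I.pairsIn T A) :=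
        add_le_add_right (Finset.sum_le_sum ih) _
    _ ≤ I.amortizedCost p U T σ := le_add_of_nonneg_right (hp.reserve_nonneg U T σ.S)
    _ ≤ I.callBound p U T := reach.amortizedCost_le hp

theorem potential_value : potential (I.beta p) (I.value p) r
    = 2 * (Real.log ((r : ℝ) + 1) + r.size) * I.value p := by
  rcases eq_or_ne r 0 with rfl | hr
  · simp [potential, rate, beta]
  have hvalue : I.value p = r * I.beta p := (mul_div_cancel₀ _ (Nat.cast_ne_zero.2 hr)).symm
  rcases eq_or_ne (I.beta p) 0 with hβ | hβ
  · simp [hvalue, hβ, potential]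
  · have hratio : (I.beta p + I.value p) / I.beta p = r + 1 := by
      rw [hvalue]
      field_simp
      ring
    rw [potential, rate, hratio, hvalue]
    ring

theorem callBound_univ : I.callBound p Finset.univ Finset.univ = factor r * I.value p := by
  change 4 * logLog (r + 1) * potential (I.beta p) (I.value p) (Finset.univ : Finset (Fin r)).card
    = _
  rw [Finset.card_fin, potential_value, factor]
  ring

end Problem

end Cost

end EDNMC

theorem theorem5p6_general :
    ∃ f : ℕ → ℝ,
      f =O[atTop] (fun r : ℕ => Real.log (r : ℝ) * Real.log (Real.log (r : ℝ))) ∧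
      ∀ (V : Type*) [Fintype V] [DecidableEq V] (r : ℕ) (I : EDNMC.Problem V r)
        (p : EDNMC.LPSol V r), I.IsFeasible 2 p →
        I.Halts p Finset.univ Finset.univ ∧
        (∃ Z, I.Returns p Finset.univ Finset.univ Z) ∧
        ∀ Z, I.Returns p Finset.univ Finset.univ Z →
          (Z : Set (Sym2 V)) ⊆ I.G.edgeSet ∧
          (∀ i, ¬ EDNMC.NodeConnected (I.G.deleteEdges (Z : Set (Sym2 V))) 2 (I.s i) (I.t i)) ∧
          I.cost Z ≤ f r * I.value p := by
  refine ⟨EDNMC.factor, EDNMC.factor_isBigO, fun V _ _ r I p hp =>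
    ⟨hp.halts _ _, hp.exists_returns _ _, fun Z hZ =>
      ⟨hZ.coe_subset_edgeSet hp, fun i => ?_, ?_⟩⟩⟩
  · have hsep := hZ.not_nodeConnected hp i (Finset.mem_univ i)
    rwa [Finset.coe_univ, SimpleGraph.spanningCoe_induce_univ] at hsep
  · exact (hZ.cost_le hp).trans_eq EDNMC.Problem.callBound_univ

theorem theorem5p6 :
    ∃ f : ℕ → ℝ,
      f =O[atTop] (fun r : ℕ => Real.log (r : ℝ) * Real.log (Real.log (r : ℝ))) ∧
      ∀ (V : Type*) [Fintype V] [DecidableEq V] (r : ℕ) (I : EDNMC.Problem V r)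
        (p : EDNMC.LPSol V r), I.IsOptimal 2 p →
        I.Halts p Finset.univ Finset.univ ∧
        (∃ Z, I.Returns p Finset.univ Finset.univ Z) ∧
        ∀ Z, I.Returns p Finset.univ Finset.univ Z →
          (Z : Set (Sym2 V)) ⊆ I.G.edgeSet ∧
          (∀ i, ¬ EDNMC.NodeConnected (I.G.deleteEdges (Z : Set (Sym2 V))) 2 (I.s i) (I.t i)) ∧
          I.cost Z ≤ f r * I.value p := by
  obtain ⟨f, hf, h⟩ := theorem5p6_general
  exact ⟨f, hf, fun V _ _ r I p hp => h V r I p hp.1⟩
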